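/- Let $k>0$ be an integer and let $a_n=k(2n+1)$, $b_n=-n^2$. Let $p_n,q_n$ be the integers defined by $u_n=a_nu_{n-1}+b_nu_{n-2}$ $(n\ge 1)$ for $u=p$ and $u=q$, with $p_{-1}=1$, $p_0=a_0$, $q_{-1}=0$, $q_0=1$; so $p_n/q_n$ is the $n$-th convergent of the polynomial continued fraction $$\mathrm{PCF}[a_n,b_n]=a_0+\cfrac{b_1}{a_1+\cfrac{b_2}{a_2+\cdots}}.$$ Put $\mathrm{GCD}[n]=\gcd(p_n,q_n)$ and $\mathrm{LCM}[n]=\operatorname{lcm}(1,2,\dots,n)$ (with $\mathrm{LCM}[0]=1$), and let $\lambda\in[0,\infty]$ be given by $$\ln\lambda=\limsup_{n\to\infty}\frac1n\ln\frac{\mathrm{GCD}[n]}{n!}$$ (the exponent of $n!$ is $\deg a_n=1$). Then: 1. $\alpha=k+\sqrt{k^2-1}$ is a root of largest modulus of $x^2=Ax+B$, where $A=2k$ and $B=-1$ are the leading coefficients of $a_n$ and $b_n$. 2. For every $n\ge 0$, the integer $n!/\mathrm{LCM}[n]$ divides $2^n\,\mathrm{GCD}[n]$; hence $\mathrm{GCD}[n]\ge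 \dfrac{n!}{2^n\,\mathrm{LCM}[n]}$. 3. $\lambda\ge \dfrac1{2e}$. 4. $q_n\ne0$ for all $n\ge0$, the sequence $p_n/q_n$ converges to a real number $L$, and the effective irrationality measure $\delta\in[-\infty,\infty]$ given by this sequence, i.e. the supremum of all real $d$ such that for all but finitely many $n$ $$\frac{p_n}{q_n}\neq L\quad\text{and}\quad\left|L-\frac{p_n}{q_n}\right|<\frac{1}{\bigl(|q_n|/\mathrm{GCD}[n]\bigr)^{1+d}},$$ satisfies $$\delta\ \ge\ \frac{\ln\!\left(k+\sqrt{k^2-1}\right)-\ln 2-1}{\ln\!\left(k+\sqrt{k^2-1}\right)+\ln 2+1}.$$ 5. If $k\ge3$, the right-hand side of the last inequality is positive and $L$ is irrational. -/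

import Mathlib

open Filter Topology Polynomial
open scoped Nat ENNReal

namespace PCF

/-- The solution `u₀, u₁, u₂, …` of the recursion `uₙ = a(n) uₙ₋₁ + b(n) uₙ₋₂` (for `n ≥ 1`)
with initial values `u₋₁ = s` and `u₀ = t`. -/
noncomputable def recSeq (a b : ℤ[X]) (s t : ℤ) : ℕ → ℤ
  | 0 => t
  | 1 => a.eval 1 * t + b.eval 1 * s
  | n + 2 => a.eval ((n : ℤ) + 2) * recSeq a b s t (n + 1)
      + b.eval ((n : ℤ) + 2) * recSeq a b s t n

/-- Numerator `pₙ` of the `n`-th convergent of `PCF[a, b]`: `p₋₁ = 1`, `p₀ = a(0)`. -/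
noncomputable def num (a b : ℤ[X]) : ℕ → ℤ := recSeq a b 1 (a.eval 0)

/-- Denominator `qₙ` of the `n`-th convergent of `PCF[a, b]`: `q₋₁ = 0`, `q₀ = 1`. -/
noncomputable def den (a b : ℤ[X]) : ℕ → ℤ := recSeq a b 0 1

/-- `GCD[n] = gcd(pₙ, qₙ)`. -/
noncomputable def gcdSeq (a b : ℤ[X]) (n : ℕ) : ℕ := Int.gcd (num a b n) (den a b n)

/-- `LCM[n]`, the least common multiple of `1, 2, …, n`. -/
def lcmUpTo (n : ℕ) : ℕ := (Finset.Icc 1 n).lcm id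

/-- `LCM[n]` divides `n!`, so that the quotient `n! / LCM[n]` in `ℕ` is exact. -/
theorem lcmUpTo_dvd_factorial (n : ℕ) : lcmUpTo n ∣ n ! :=
  Finset.lcm_dvd fun _ hm =>
    Nat.dvd_factorial (Finset.mem_Icc.mp hm).1 (Finset.mem_Icc.mp hm).2

/-- `α` is a root of largest modulus of `x² = A x + B`, where `A` and `B` are the leading
coefficients of `a` and `b`. -/
def IsDominantRoot (a b : ℤ[X]) (α : ℂ) : Prop :=
  α ^ 2 = (a.leadingCoeff : ℂ) * α + (b.leadingCoeff : ℂ) ∧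
    ∀ β : ℂ, β ^ 2 = (a.leadingCoeff : ℂ) * β + (b.leadingCoeff : ℂ) → ‖β‖ ≤ ‖α‖

/-- `ln λ = limsup (1/n) ln (GCD[n] / n! ^ deg a)`, an extended real. -/
noncomputable def logLam (a b : ℤ[X]) : EReal :=
  limsup (fun n : ℕ =>
    ENNReal.log ((gcdSeq a b n : ℝ≥0∞) / (n ! : ℝ≥0∞) ^ a.natDegree) / (n : EReal)) atTop

/-- The number `λ ∈ [0, ∞]` with `ln λ = limsup (1/n) ln (GCD[n] / n! ^ deg a)`. -/
noncomputable def lam (a b : ℤ[X]) : ℝ≥0∞ := EReal.exp (logLam a b)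

/-- The real number `δ` is admissible for the convergents `pₙ/qₙ` of `PCF[a, b]` and the number
`L`: for all but finitely many `n` one has `pₙ/qₙ ≠ L` and `|L - pₙ/qₙ| < 1 / Q ^ (1 + δ)`, where
`Q = |qₙ| / gcd(pₙ, qₙ)` is the denominator of `pₙ/qₙ` in lowest terms. -/
def IsAdmissible (a b : ℤ[X]) (L δ : ℝ) : Prop :=
  ∀ᶠ n : ℕ in atTop, (num a b n : ℝ) / (den a b n : ℝ) ≠ L ∧
    |L - (num a b n : ℝ) / (den a b n : ℝ)|
      < 1 / (|(den a b n : ℝ)| / (gcdSeq a b n : ℝ)) ^ (1 + δ)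

/-- The effective irrationality measure of `L` given by the convergents of `PCF[a, b]`: the
supremum, in the extended reals, of the admissible exponents. -/
noncomputable def effMeasure (a b : ℤ[X]) (L : ℝ) : EReal :=
  sSup {x : EReal | ∃ δ : ℝ, IsAdmissible a b L δ ∧ x = (δ : EReal)}

/-- The polynomial `a(n) = k (2 n + 1)`. -/
noncomputable def aPoly (k : ℤ) : ℤ[X] := C k * (2 * X + 1)

/-- The polynomial `b(n) = -n²`. -/
noncomputable def bPoly : ℤ[X] := -X ^ 2

/-- The number `α = k + √(k² - 1)`. -/
noncomputable def alpha (k : ℤ) : ℝ := (k : ℝ) + √((k : ℝ) ^ 2 - 1)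

/-- The number `(ln (k + √(k² - 1)) - ln 2 - 1) / (ln (k + √(k² - 1)) + ln 2 + 1)`. -/
noncomputable def deltaBound (k : ℤ) : ℝ :=
  (Real.log (alpha k) - Real.log 2 - 1) / (Real.log (alpha k) + Real.log 2 + 1)

end PCF

/-! ### A Tauberian upper bound with the Fejér kernel -/

section WienerIkehara

open MeasureTheory Set

/-! Dividing the recursion by `(n + 1)!` turns it into Bonnet's recursion for Legendre polynomials
at `k`: `pₙ = (n + 1)! Pₙ₊₁` and `qₙ = (n + 1)! Wₙ₊₁`, where `P = legSeq k 1 k` and `W = legSeq k 0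
1`.

Arithmetic. The generating series `G` of `P` satisfies `(1 - 2kX + X²) G² = 1`, so `G²` has integer
coefficients and `2ⁿ Pₙ₊₁` is an integer. Variation of constants gives `W = G ∫ G`; integration
costs denominators up to `n + 1`, so `LCM[n+1] 2ⁿ Wₙ₊₁` is an integer. Restoring the factorial shows
that `n! / LCM[n]` divides both `2ⁿ pₙ` and `2ⁿ qₙ`.

Analysis. The Casoratian of `P` and `W` makes the convergents decrease by `1 / ((n+2) Wₙ₊₂ Wₙ₊₁)`.
For `k ≥ 2`, `Wₙ₊₁` equals `αⁿ` up to a factor at most `n + 1`, so the error is `α^(-2n)` up to a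
polynomial factor, and the reduced denominator is at most `(n+1) (2α)ⁿ LCM[n]`.

The constant `e` comes from `LCM[n] ≤ e^((1+o(1)) n)`, that is, the upper half of the prime number
theorem, since `ln LCM[n] = ψ(n)`. It is proved by the Wiener–Ikehara method
(`eventually_le_of_laplace_continuous`) from the continuity on `Re s ≥ 1` of `-ζ'/ζ` minus its pole.
Comparing exponents gives `1 + δ ≥ 2 ln α / (ln α + ln 2 + 1)`; a positive admissible exponent
forces irrationality. -/

theorem integral_triangle_mul_exp (c : ℂ) (hc : c ≠ 0) :
    ∫ u in (-1 : ℝ)..1, ((1 - |u| : ℝ) : ℂ) * Complex.exp (c * u)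
      = (Complex.exp c + Complex.exp (-c) - 2) / c ^ 2 := by
  have hcont : Continuous fun u : ℝ => ((1 - |u| : ℝ) : ℂ) * Complex.exp (c * u) := by fun_prop
  rw [← intervalIntegral.integral_add_adjacent_intervals (b := 0)
    (hcont.intervalIntegrable _ _) (hcont.intervalIntegrable _ _)]
  have h1 : ∫ u in (0 : ℝ)..1, ((1 - |u| : ℝ) : ℂ) * Complex.exp (c * u)
      = Complex.exp c / c ^ 2 - 1 / c - 1 / c ^ 2 := by
    have : ∫ u in (0 : ℝ)..1, ((1 - |u| : ℝ) : ℂ) * Complex.exp (c * u)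
        = ∫ u in (0 : ℝ)..1, (1 - (u : ℂ)) * Complex.exp (c * u) := by
      refine intervalIntegral.integral_congr fun u hu => ?_
      rw [uIcc_of_le zero_le_one] at hu
      simp [abs_of_nonneg hu.1]
    rw [this, intervalIntegral.integral_eq_sub_of_hasDerivAt
      (f := fun u : ℝ => Complex.exp (c * u) * ((1 - (u : ℂ)) / c + 1 / c ^ 2))]
    · simp; field_simp; ring
    · intro u _
      have hu : HasDerivAt (fun u : ℝ => (u : ℂ)) 1 u := Complex.ofRealCLM.hasDerivAt
      refine (((hu.const_mul c).cexp).mul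
        (((hu.const_sub 1).div_const c).add_const (1 / c ^ 2))).congr_deriv ?_
      field_simp; ring
    · exact (by fun_prop : Continuous _).intervalIntegrable _ _
  have h2 : ∫ u in (-1 : ℝ)..0, ((1 - |u| : ℝ) : ℂ) * Complex.exp (c * u)
      = Complex.exp (-c) / c ^ 2 + 1 / c - 1 / c ^ 2 := by
    have : ∫ u in (-1 : ℝ)..0, ((1 - |u| : ℝ) : ℂ) * Complex.exp (c * u)
        = ∫ u in (-1 : ℝ)..0, (1 + (u : ℂ)) * Complex.exp (c * u) := by
      refine intervalIntegral.integral_congr fun u hu => ?_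
      rw [uIcc_of_le (by norm_num)] at hu
      simp [abs_of_nonpos hu.2]
    rw [this, intervalIntegral.integral_eq_sub_of_hasDerivAt
      (f := fun u : ℝ => Complex.exp (c * u) * ((1 + (u : ℂ)) / c - 1 / c ^ 2))]
    · simp; field_simp; ring
    · intro u _
      have hu : HasDerivAt (fun u : ℝ => (u : ℂ)) 1 u := Complex.ofRealCLM.hasDerivAt
      refine (((hu.const_mul c).cexp).mul
        (((hu.const_add 1).div_const c).sub_const (1 / c ^ 2))).congr_deriv ?_
      field_simp; ring
    · exact (by fun_prop : Continuous _).intervalIntegrable _ _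
  rw [h1, h2]; field_simp; ring

/-- The squared sinc function is the Fourier transform of the triangle function. -/
theorem integral_triangle_eq_sinc_sq (w : ℝ) :
    ∫ u in (-1 : ℝ)..1, ((1 - |u| : ℝ) : ℂ) * Complex.exp (2 * w * Complex.I * u)
      = ((Real.sinc w ^ 2 : ℝ) : ℂ) := by
  have key : ∀ w : ℝ, w ≠ 0 →
      ∫ u in (-1 : ℝ)..1, ((1 - |u| : ℝ) : ℂ) * Complex.exp (2 * w * Complex.I * u)
        = ((Real.sinc w ^ 2 : ℝ) : ℂ) := by
    intro w hw
    have hw' : (w : ℂ) ≠ 0 := Complex.ofReal_ne_zero.mpr hw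
    rw [integral_triangle_mul_exp _ (by simp [hw]), Real.sinc_of_ne_zero hw]
    have h : Complex.exp (2 * w * Complex.I) + Complex.exp (-(2 * w * Complex.I)) - 2
        = -4 * Complex.sin w ^ 2 := by
      have := Complex.two_cos (2 * (w : ℂ))
      rw [neg_mul, Complex.cos_two_mul] at this
      rw [← this, Complex.cos_sq']; ring
    rw [h]
    push_cast
    have hI : Complex.I ^ 2 = -1 := Complex.I_sq
    rw [mul_pow, hI]
    field_simp
    ring
  -- The closed form divides by `w`; the value at `0` follows by continuity of both sides.
  refine congrFun (Continuous.ext_on (dense_compl_singleton (0 : ℝ)) ?_ ?_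
    (fun w hw => key w hw)) w
  · exact intervalIntegral.continuous_parametric_intervalIntegral_of_continuous'
      (by fun_prop) _ _
  · have := Real.continuous_sinc
    fun_prop

theorem sinc_sq_le (x : ℝ) : Real.sinc x ^ 2 ≤ 2 * (1 + x ^ 2)⁻¹ := by
  rw [← div_eq_mul_inv, le_div_iff₀ (by positivity)]
  have h1 : Real.sinc x ^ 2 ≤ 1 := by
    rw [sq_le_one_iff_abs_le_one]; exact Real.abs_sinc_le_one x
  have h2 : Real.sinc x ^ 2 * x ^ 2 ≤ 1 := by
    rcases eq_or_ne x 0 with rfl | hx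
    · simp
    · rw [← mul_pow, Real.sinc_of_ne_zero hx, div_mul_cancel₀ _ hx]
      exact Real.sin_sq_le_one x
  linarith

theorem integrable_sinc_sq : Integrable fun x : ℝ => Real.sinc x ^ 2 := by
  refine Integrable.mono' (integrable_inv_one_add_sq.const_mul 2)
    (Real.continuous_sinc.pow 2).aestronglyMeasurable (Eventually.of_forall fun x => ?_)
  rw [Real.norm_of_nonneg (sq_nonneg _)]
  exact sinc_sq_le x

theorem integral_sinc_sq_pos : 0 < ∫ x : ℝ, Real.sinc x ^ 2 := by
  rw [integral_pos_iff_support_of_nonneg (fun x => sq_nonneg _) integrable_sinc_sq]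
  exact (Real.continuous_sinc.pow 2).isOpen_support.measure_pos _ ⟨0, by simp⟩

theorem integrable_sinc_sq_comp {R : ℝ} (hR : 0 < R) (y : ℝ) :
    Integrable fun t : ℝ => Real.sinc (R * (y - t)) ^ 2 := by
  have h := (integrable_sinc_sq.comp_mul_left' hR.ne').comp_sub_left y
  exact h

/-- Smoothed form of the boundary behaviour of a Laplace transform, before the passage to the
boundary line. -/
theorem integral_mul_sinc_sq_eq {f : ℝ → ℝ} {M : ℝ} (hf : Measurable f)
    (hM : ∀ t, 0 < t → |f t| ≤ M) {G : ℝ → ℝ → ℂ}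
    (hFG : ∀ ε : ℝ, 0 < ε → ∀ u : ℝ,
      ∫ t in Ioi (0 : ℝ), (f t : ℂ) * Complex.exp (-(ε + u * Complex.I) * t) = G ε u)
    (R y : ℝ) {ε : ℝ} (hε : 0 < ε) :
    ((∫ t in Ioi (0 : ℝ), f t * Real.exp (-ε * t) * Real.sinc (R * (y - t)) ^ 2 : ℝ) : ℂ)
      = ∫ u in (-1 : ℝ)..1, ((1 - |u| : ℝ) : ℂ) * Complex.exp (2 * (R * y) * Complex.I * u)
          * G ε (2 * R * u) := by
  -- The damping `exp (-ε t)` supplies the integrable majorant needed for Fubini.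
  have hint : Integrable (Function.uncurry fun (t u : ℝ) =>
      (f t * Real.exp (-ε * t) : ℂ) *
        (((1 - |u| : ℝ) : ℂ) * Complex.exp (2 * ((R * (y - t) : ℝ) : ℂ) * Complex.I * u)))
      ((volume.restrict (Ioi (0 : ℝ))).prod (volume.restrict (Ioc (-1 : ℝ) 1))) := by
    have h1 : Integrable (fun t : ℝ => M * Real.exp (-ε * t)) (volume.restrict (Ioi (0 : ℝ))) :=
      (exp_neg_integrableOn_Ioi 0 hε).const_mul M
    have h2 : Integrable (fun u : ℝ => (1 - |u|)) (volume.restrict (Ioc (-1 : ℝ) 1)) :=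
      (by fun_prop : Continuous fun u : ℝ => (1 - |u|)).integrableOn_Ioc
    refine Integrable.mono' (h1.mul_prod h2) ?_ ?_
    · refine Measurable.aestronglyMeasurable ?_
      unfold Function.uncurry
      fun_prop
    · rw [Measure.prod_restrict]
      refine (ae_restrict_iff' (measurableSet_Ioi.prod measurableSet_Ioc)).mpr
        (Eventually.of_forall ?_)
      rintro ⟨t, u⟩ ⟨ht, hu⟩
      have hu' : 0 ≤ 1 - |u| := by
        have := abs_le.mpr ⟨hu.1.le, hu.2⟩
        linarith
      have e1 : ‖Complex.exp (2 * ((R * (y - t) : ℝ) : ℂ) * Complex.I * u)‖ = 1 := by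
        rw [show (2 * ((R * (y - t) : ℝ) : ℂ) * Complex.I * u)
          = ((2 * (R * (y - t)) * u : ℝ) : ℂ) * Complex.I by push_cast; ring]
        exact Complex.norm_exp_ofReal_mul_I _
      simp only [Function.uncurry_apply_pair, norm_mul, e1, mul_one, Complex.norm_real,
        Real.norm_eq_abs, Real.abs_exp, abs_of_nonneg hu']
      gcongr
      exact hM t ht
  have h := integral_integral_swap hint
  rw [← integral_complex_ofReal]
  refine Eq.trans ?_ (h.trans ?_)
  · refine integral_congr_ae (Eventually.of_forall fun t => ?_)
    simp only
    rw [integral_const_mul, ← intervalIntegral.integral_of_le (by norm_num),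
      integral_triangle_eq_sinc_sq]
    push_cast
    ring
  · rw [intervalIntegral.integral_of_le (by norm_num)]
    refine integral_congr_ae (Eventually.of_forall fun u => ?_)
    simp only
    rw [← hFG ε hε (2 * R * u), ← integral_const_mul]
    refine integral_congr_ae (Eventually.of_forall fun t => ?_)
    simp only
    have : Complex.exp (2 * ((R * (y - t) : ℝ) : ℂ) * Complex.I * u) * (Real.exp (-ε * t) : ℂ)
        = Complex.exp (2 * (R * y) * Complex.I * u)
          * Complex.exp (-(ε + (2 * R * u : ℝ) * Complex.I) * t) := by
      rw [Complex.ofReal_exp, ← Complex.exp_add, ← Complex.exp_add]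
      congr 1
      push_cast
      ring
    linear_combination ((f t : ℂ) * ((1 - |u| : ℝ) : ℂ)) * this

/-- If the Laplace transform of a bounded function `f` extends continuously to the imaginary axis,
then the averages of `f` against translates of the Fejér kernel tend to zero. -/
theorem tendsto_integral_mul_sinc_sq {f : ℝ → ℝ} {M : ℝ} (hf : Measurable f)
    (hM : ∀ t, 0 < t → |f t| ≤ M) {G : ℝ → ℝ → ℂ} (hG : Continuous (Function.uncurry G))
    (hFG : ∀ ε : ℝ, 0 < ε → ∀ u : ℝ,
      ∫ t in Ioi (0 : ℝ), (f t : ℂ) * Complex.exp (-(ε + u * Complex.I) * t) = G ε u)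
    {R : ℝ} (hR : 0 < R) :
    Tendsto (fun y : ℝ => ∫ t in Ioi (0 : ℝ), f t * Real.sinc (R * (y - t)) ^ 2) atTop (𝓝 0) := by
  have heq : ∀ y : ℝ, ((∫ t in Ioi (0 : ℝ), f t * Real.sinc (R * (y - t)) ^ 2 : ℝ) : ℂ)
      = ∫ u in (-1 : ℝ)..1, ((1 - |u| : ℝ) : ℂ) * Complex.exp (2 * (R * y) * Complex.I * u)
          * G 0 (2 * R * u) := by
    intro y
    have hl : Tendsto (fun ε : ℝ =>
        ∫ t in Ioi (0 : ℝ), f t * Real.exp (-ε * t) * Real.sinc (R * (y - t)) ^ 2) (𝓝[>] 0)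
        (𝓝 (∫ t in Ioi (0 : ℝ), f t * Real.sinc (R * (y - t)) ^ 2)) := by
      refine tendsto_integral_filter_of_dominated_convergence
        (fun t => M * Real.sinc (R * (y - t)) ^ 2) ?_ ?_ ?_ ?_
      · refine Eventually.of_forall fun ε => Measurable.aestronglyMeasurable ?_
        have := Real.continuous_sinc.measurable
        fun_prop
      · filter_upwards [self_mem_nhdsWithin] with ε hε
        refine (ae_restrict_iff' measurableSet_Ioi).mpr (Eventually.of_forall fun t ht => ?_)
        have ht : 0 < t := ht
        have hε : 0 < ε := hε
        rw [norm_mul, norm_mul, Real.norm_of_nonneg (sq_nonneg (Real.sinc _)), Real.norm_eq_abs,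
          Real.norm_eq_abs, Real.abs_exp]
        have h1 : Real.exp (-ε * t) ≤ 1 := Real.exp_le_one_iff.mpr (by nlinarith)
        have h0 := abs_nonneg (f t)
        gcongr
        calc |f t| * Real.exp (-ε * t) ≤ |f t| * 1 := by gcongr
          _ ≤ M := by rw [mul_one]; exact hM t ht
      · exact ((integrable_sinc_sq_comp hR y).const_mul M).integrableOn
      · refine Eventually.of_forall fun t => ?_
        have : Continuous fun ε : ℝ => f t * Real.exp (-ε * t) * Real.sinc (R * (y - t)) ^ 2 := by
          fun_prop
        simpa using (this.tendsto 0).mono_left nhdsWithin_le_nhds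
    have hr : Tendsto (fun ε : ℝ => ∫ u in (-1 : ℝ)..1, ((1 - |u| : ℝ) : ℂ)
          * Complex.exp (2 * (R * y) * Complex.I * u) * G ε (2 * R * u)) (𝓝[>] 0)
        (𝓝 (∫ u in (-1 : ℝ)..1, ((1 - |u| : ℝ) : ℂ)
          * Complex.exp (2 * (R * y) * Complex.I * u) * G 0 (2 * R * u))) := by
      refine Tendsto.mono_left (Continuous.tendsto ?_ 0) nhdsWithin_le_nhds
      refine intervalIntegral.continuous_parametric_intervalIntegral_of_continuous' ?_ _ _
      have h1 : Continuous fun p : ℝ × ℝ => G p.1 (2 * R * p.2) :=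
        hG.comp (f := fun p : ℝ × ℝ => (p.1, 2 * R * p.2)) (by fun_prop)
      have h2 : Continuous fun p : ℝ × ℝ => ((1 - |p.2| : ℝ) : ℂ)
          * Complex.exp (2 * (R * y) * Complex.I * p.2) := by fun_prop
      exact h2.mul h1
    refine tendsto_nhds_unique ((Complex.continuous_ofReal.tendsto _).comp hl)
      (hr.congr' ?_)
    filter_upwards [self_mem_nhdsWithin] with ε hε
    exact (integral_mul_sinc_sq_eq hf hM hFG R y hε).symm
  -- Riemann–Lebesgue on the boundary line. The Fourier character is `exp (2πi ·)`, hence the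
  -- frequency `-(R y / π)` below.
  have hRL := Real.tendsto_integral_exp_smul_cocompact
    ((Ioc (-1 : ℝ) 1).indicator fun u : ℝ => ((1 - |u| : ℝ) : ℂ) * G 0 (2 * R * u))
  have hc : Tendsto (fun y : ℝ => -(R * y / Real.pi)) atTop (cocompact ℝ) := by
    refine Tendsto.mono_right ?_ atBot_le_cocompact
    refine tendsto_neg_atTop_atBot.comp ?_
    exact (tendsto_id.const_mul_atTop hR).atTop_div_const Real.pi_pos
  have h := hRL.comp hc
  have h' : Tendsto (fun y : ℝ =>
      ((∫ t in Ioi (0 : ℝ), f t * Real.sinc (R * (y - t)) ^ 2 : ℝ) : ℂ)) atTop (𝓝 ((0 : ℝ) : ℂ)) := by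
    rw [Complex.ofReal_zero]
    refine h.congr fun y => ?_
    rw [heq, intervalIntegral.integral_of_le (by norm_num), ← integral_indicator measurableSet_Ioc]
    refine integral_congr_ae (Eventually.of_forall fun u => ?_)
    simp only [indicator, Circle.smul_def, Real.fourierChar_apply, smul_eq_mul]
    split_ifs
    · have : (((2 * Real.pi * -(u * -(R * y / Real.pi)) : ℝ) : ℂ) * Complex.I)
          = 2 * (R * y) * Complex.I * u := by
        rw [show 2 * Real.pi * -(u * -(R * y / Real.pi)) = 2 * (R * y) * u by
          field_simp]
        push_cast
        ring
      rw [this]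
      ring
    · simp
  exact (Complex.continuous_re.tendsto _).comp h'

/-- Tauberian upper bound: a bounded nonnegative function on the half-line that decays at most
like `exp (-t)` and whose Laplace transform minus that of `1` extends continuously to the imaginary
axis has upper limit at most `1`. -/
theorem eventually_le_of_laplace_continuous {B : ℝ → ℝ} {M : ℝ} (hB : Measurable B)
    (hB0 : ∀ t, 0 ≤ B t) (hM : ∀ t, 0 < t → |B t - 1| ≤ M)
    (hmono : ∀ z t, z ≤ t → B z * Real.exp (-(t - z)) ≤ B t)
    {G : ℝ → ℝ → ℂ} (hG : Continuous (Function.uncurry G))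
    (hFG : ∀ ε : ℝ, 0 < ε → ∀ u : ℝ,
      ∫ t in Ioi (0 : ℝ), ((B t - 1 : ℝ) : ℂ) * Complex.exp (-(ε + u * Complex.I) * t) = G ε u)
    {c : ℝ} (hc : 1 < c) : ∀ᶠ z in atTop, B z ≤ c := by
  set I := ∫ x : ℝ, Real.sinc x ^ 2 with hI
  have hIpos : 0 < I := integral_sinc_sq_pos
  -- choose the truncation
  have hlim : Tendsto (fun a : ℝ => ∫ x in (-a)..a, Real.sinc x ^ 2) atTop (𝓝 I) :=
    intervalIntegral_tendsto_integral integrable_sinc_sq tendsto_neg_atTop_atBot tendsto_id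
  -- Three losses of a factor `d`: truncating the kernel to `[-a, a]`, the decay of `B` across a
  -- window of length `2a/R`, and the error of the smoothed limit.
  obtain ⟨d, hd1, hdc⟩ : ∃ d, 1 < d ∧ d ^ 3 < c := by
    have : Tendsto (fun d : ℝ => d ^ 3) (𝓝[>] 1) (𝓝 1) := by
      simpa using ((continuous_pow 3).tendsto (1 : ℝ)).mono_left nhdsWithin_le_nhds
    exact ((this.eventually_lt_const hc).and self_mem_nhdsWithin).exists.imp
      fun d h => ⟨h.2, h.1⟩
  obtain ⟨a, ha0, ha⟩ : ∃ a : ℝ, 0 < a ∧ I / d < ∫ x in (-a)..a, Real.sinc x ^ 2 :=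
    ((eventually_gt_atTop 0).and
      (hlim.eventually_const_lt (div_lt_self hIpos hd1))).exists
  set J := ∫ x in (-a)..a, Real.sinc x ^ 2 with hJ
  have hJpos : 0 < J := (div_pos hIpos (by linarith)).trans ha
  obtain ⟨R, hR, hRd⟩ : ∃ R : ℝ, 0 < R ∧ Real.exp (2 * a / R) < d := by
    have h0 : Tendsto (fun R : ℝ => Real.exp (2 * a / R)) atTop (𝓝 (Real.exp 0)) :=
      (Real.continuous_exp.tendsto 0).comp (tendsto_const_nhds.div_atTop tendsto_id)
    rw [Real.exp_zero] at h0
    exact ((eventually_gt_atTop 0).and (h0.eventually_lt_const hd1)).exists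
  have hT := tendsto_integral_mul_sinc_sq (hB.sub_const 1) hM hG hFG hR
  have hη : 0 < (d - 1) * I / R := by
    have := sub_pos.mpr hd1
    positivity
  have hshift : Tendsto (fun z : ℝ => z + a / R) atTop atTop :=
    tendsto_atTop_add_const_right _ _ tendsto_id
  filter_upwards [hshift.eventually (hT.eventually_lt_const hη), eventually_gt_atTop 0]
    with z hz hz0
  -- The kernel is centred so that its truncated part covers exactly `[z, z + 2a/R]`, where `B` is
  -- bounded below in terms of `B z`.
  set y := z + a / R with hy
  have hK := integrable_sinc_sq_comp hR y
  have hBK : IntegrableOn (fun t => (B t - 1) * Real.sinc (R * (y - t)) ^ 2) (Ioi 0) := by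
    refine Integrable.mono' ((hK.const_mul M).integrableOn) ?_ ?_
    · refine Measurable.aestronglyMeasurable ?_
      have := Real.continuous_sinc.measurable
      fun_prop
    · refine (ae_restrict_iff' measurableSet_Ioi).mpr (Eventually.of_forall fun t ht => ?_)
      rw [norm_mul, Real.norm_of_nonneg (sq_nonneg (Real.sinc _)), Real.norm_eq_abs]
      gcongr
      exact hM t ht
  have hBK' : IntegrableOn (fun t => B t * Real.sinc (R * (y - t)) ^ 2) (Ioi 0) := by
    refine (hBK.add hK.integrableOn).congr (Eventually.of_forall fun t => ?_)
    simp only [Pi.add_apply]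
    ring
  have htot : ∫ t in Ioi (0 : ℝ), B t * Real.sinc (R * (y - t)) ^ 2 ≤ d * I / R := by
    have e1 : ∫ t in Ioi (0 : ℝ), B t * Real.sinc (R * (y - t)) ^ 2
        = (∫ t in Ioi (0 : ℝ), (B t - 1) * Real.sinc (R * (y - t)) ^ 2)
          + ∫ t in Ioi (0 : ℝ), Real.sinc (R * (y - t)) ^ 2 := by
      rw [← integral_add hBK hK.integrableOn]
      refine integral_congr_ae (Eventually.of_forall fun t => ?_)
      simp only
      ring
    have e2 : ∫ t in Ioi (0 : ℝ), Real.sinc (R * (y - t)) ^ 2 ≤ I / R := by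
      calc ∫ t in Ioi (0 : ℝ), Real.sinc (R * (y - t)) ^ 2
          ≤ ∫ t : ℝ, Real.sinc (R * (y - t)) ^ 2 :=
            setIntegral_le_integral hK (Eventually.of_forall fun t => sq_nonneg _)
        _ = I / R := by
            rw [integral_sub_left_eq_self (fun t => Real.sinc (R * t) ^ 2) volume y,
              Measure.integral_comp_mul_left (fun t => Real.sinc t ^ 2) R,
              abs_of_pos (inv_pos.mpr hR), smul_eq_mul]
            ring
    rw [e1]
    have : (d - 1) * I / R + I / R = d * I / R := by ring
    linarith
  have hlow : B z * Real.exp (-(2 * a / R)) * (J / R)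
      ≤ ∫ t in Ioi (0 : ℝ), B t * Real.sinc (R * (y - t)) ^ 2 := by
    have hle : z ≤ z + 2 * a / R := by
      have : 0 ≤ 2 * a / R := by positivity
      linarith
    calc B z * Real.exp (-(2 * a / R)) * (J / R)
        = ∫ t in z..(z + 2 * a / R),
            B z * Real.exp (-(2 * a / R)) * Real.sinc (R * (y - t)) ^ 2 := by
          rw [intervalIntegral.integral_const_mul]
          congr 1
          have e := intervalIntegral.integral_comp_sub_mul (a := z) (b := z + 2 * a / R)
            (fun t => Real.sinc t ^ 2) hR.ne' (R * y)
          have e3 : R * y - R * (z + 2 * a / R) = -a := by rw [hy]; field_simp; ring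
          have e4 : R * y - R * z = a := by rw [hy]; field_simp; ring
          rw [e3, e4] at e
          simp_rw [mul_sub]
          rw [e, smul_eq_mul]
          ring
      _ = ∫ t in Ioc z (z + 2 * a / R),
            B z * Real.exp (-(2 * a / R)) * Real.sinc (R * (y - t)) ^ 2 :=
          intervalIntegral.integral_of_le hle
      _ ≤ ∫ t in Ioc z (z + 2 * a / R), B t * Real.sinc (R * (y - t)) ^ 2 := by
          refine setIntegral_mono_on (hK.const_mul _).integrableOn
            (hBK'.mono_set fun t ht => hz0.trans ht.1) measurableSet_Ioc fun t ht => ?_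
          gcongr
          refine le_trans ?_ (hmono z t ht.1.le)
          have := hB0 z
          gcongr
          linarith [ht.2]
      _ ≤ _ := by
          refine setIntegral_mono_set hBK' (Eventually.of_forall fun t =>
            mul_nonneg (hB0 t) (sq_nonneg _)) ?_
          exact (show Ioc z (z + 2 * a / R) ⊆ Ioi 0 from fun t ht => hz0.trans ht.1).eventuallyLE
  have h1 : B z * Real.exp (-(2 * a / R)) * J ≤ d * I := by
    have := hlow.trans htot
    rw [← mul_div_assoc] at this
    exact (div_le_div_iff_of_pos_right hR).mp this
  have h2 : I ≤ d * J := by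
    rw [div_lt_iff₀ (by linarith)] at ha
    linarith
  have h3 : B z * Real.exp (-(2 * a / R)) ≤ d ^ 2 := by
    refine le_of_mul_le_mul_right ?_ hJpos
    nlinarith
  rw [Real.exp_neg, ← div_eq_mul_inv, div_le_iff₀ (Real.exp_pos _)] at h3
  nlinarith [sq_nonneg d, hB0 z]

end WienerIkehara

/-! ### Chebyshev's `ψ` and the growth of `lcm(1, …, n)` -/

section PrimeNumberTheorem

open MeasureTheory Set ArithmeticFunction

/-- The normalised Chebyshev function `ψ(e^t) e^{-t}`. -/
noncomputable def psiExp (t : ℝ) : ℝ := Chebyshev.psi (Real.exp t) * Real.exp (-t)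

theorem psiExp_nonneg (t : ℝ) : 0 ≤ psiExp t :=
  mul_nonneg (Chebyshev.psi_nonneg _) (Real.exp_pos _).le

theorem measurable_psiExp : Measurable psiExp := by
  have h := Chebyshev.psi_mono.measurable
  unfold psiExp
  fun_prop

theorem psiExp_le (t : ℝ) : psiExp t ≤ Real.log 4 + 4 := by
  have h := Chebyshev.psi_le_const_mul_self (Real.exp_pos t).le
  unfold psiExp
  rw [Real.exp_neg, ← div_eq_mul_inv, div_le_iff₀ (Real.exp_pos t)]
  exact h

theorem abs_psiExp_sub_one_le (t : ℝ) : |psiExp t - 1| ≤ Real.log 4 + 4 := by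
  have h0 := psiExp_nonneg t
  have h1 := psiExp_le t
  have : 0 ≤ Real.log 4 := Real.log_nonneg (by norm_num)
  rw [abs_le]
  constructor <;> linarith

theorem psiExp_mul_exp_le {z t : ℝ} (h : z ≤ t) : psiExp z * Real.exp (-(t - z)) ≤ psiExp t := by
  unfold psiExp
  rw [mul_assoc, ← Real.exp_add, show -z + -(t - z) = -t by ring]
  gcongr

theorem residueClass_one_eq (a : ZMod 1) (n : ℕ) : vonMangoldt.residueClass a n = Λ n := by
  have : (n : ZMod 1) = a := Subsingleton.elim _ _
  simp [vonMangoldt.residueClass, this]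

/-- Abel summation gives `s ∫ ψ(x) x^(-s-1) dx` over `x > 1`; then substitute `x = e^t`. -/
theorem LSeries_vonMangoldt_eq_laplace {s : ℂ} (hs : 1 < s.re) :
    LSeries (fun n => (Λ n : ℂ)) s
      = s * ∫ t in Ioi (0 : ℝ), (psiExp t : ℂ) * Complex.exp (-(s - 1) * t) := by
  have hpsi : ∀ n : ℕ, ∑ k ∈ Finset.Icc 1 n, Λ k = Chebyshev.psi n := by
    intro n
    rw [Chebyshev.psi]
    simp
    rfl
  rw [LSeries_eq_mul_integral_of_nonneg (fun n => Λ n) zero_le_one hs ?_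
    (fun n => vonMangoldt_nonneg)]
  · congr 1
    have h := integral_comp_exp_Ioi (fun x : ℝ =>
      (∑ k ∈ Finset.Icc 1 ⌊x⌋₊, ((Λ k : ℝ) : ℂ)) * (x : ℂ) ^ (-(s + 1))) 0
    rw [Real.exp_zero] at h
    rw [← h]
    refine integral_congr_ae (Eventually.of_forall fun t => ?_)
    simp only
    rw [← Complex.ofReal_sum, hpsi, ← Chebyshev.psi_eq_psi_coe_floor, psiExp, Complex.real_smul,
      Complex.cpow_def_of_ne_zero (by simp), ← Complex.ofReal_log (Real.exp_pos t).le,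
      Real.log_exp]
    push_cast
    rw [mul_left_comm, ← Complex.exp_add, mul_assoc, ← Complex.exp_add]
    congr 2
    ring
  · refine Asymptotics.IsBigO.of_bound (Real.log 4 + 4) (Eventually.of_forall fun n => ?_)
    rw [hpsi, Real.rpow_one, Real.norm_of_nonneg (Chebyshev.psi_nonneg _),
      Real.norm_of_nonneg (Nat.cast_nonneg n)]
    exact Chebyshev.psi_le_const_mul_self (Nat.cast_nonneg n)

/-- The continuous boundary extension of the Laplace transform of `ψ(e^t) e^{-t} - 1`. -/
noncomputable def psiBoundary (ε u : ℝ) : ℂ :=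
  (vonMangoldt.LFunctionResidueClassAux (1 : ZMod 1) (1 + (max ε 0 : ℝ) + u * Complex.I) - 1)
    / (1 + (max ε 0 : ℝ) + u * Complex.I)

/-- The truncation `max ε 0` keeps the argument in `Re s ≥ 1`, where the auxiliary function is
continuous, so continuity holds on the whole plane. -/
theorem continuous_psiBoundary : Continuous (Function.uncurry psiBoundary) := by
  have hre : ∀ p : ℝ × ℝ, (1 + (max p.1 0 : ℝ) + p.2 * Complex.I : ℂ).re = 1 + max p.1 0 := by
    intro p; simp
  have hc : Continuous fun p : ℝ × ℝ => (1 + (max p.1 0 : ℝ) + p.2 * Complex.I : ℂ) := by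
    fun_prop
  have h := (vonMangoldt.continuousOn_LFunctionResidueClassAux (1 : ZMod 1)).comp_continuous hc
    (fun p => by
      have := le_max_right p.1 0
      change 1 ≤ (1 + (max p.1 0 : ℝ) + p.2 * Complex.I : ℂ).re
      rw [hre]
      linarith)
  refine (h.sub continuous_const).div hc fun p hp => ?_
  have := congrArg Complex.re hp
  rw [hre, Complex.zero_re] at this
  have := le_max_right p.1 0
  linarith

/-- With `s = 1 + w`, the transform of `1` is `1/w`, which cancels the pole: `(F + 1/w)/s - 1/w = (F
- 1)/s`, where `F` is the auxiliary function. -/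
theorem integral_psiExp_sub_one_eq {ε : ℝ} (hε : 0 < ε) (u : ℝ) :
    ∫ t in Ioi (0 : ℝ), ((psiExp t - 1 : ℝ) : ℂ) * Complex.exp (-(ε + u * Complex.I) * t)
      = psiBoundary ε u := by
  set w : ℂ := ε + u * Complex.I with hw
  have hwre : w.re = ε := by simp [hw]
  have hwne : w ≠ 0 := fun h => by
    rw [h, Complex.zero_re] at hwre
    exact hε.ne hwre
  have hs1 : 1 < (1 + w).re := by simp [hwre, hε]
  have hsne : 1 + w ≠ 0 := fun h => by
    rw [h, Complex.zero_re] at hs1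
    linarith
  have hneg : (-w).re < 0 := by simp [hwre, hε]
  have hexp : IntegrableOn (fun t : ℝ => Complex.exp (-w * t)) (Ioi 0) :=
    integrableOn_exp_mul_complex_Ioi hneg 0
  have hmul : IntegrableOn (fun t : ℝ => (psiExp t : ℂ) * Complex.exp (-w * t)) (Ioi 0) := by
    refine Integrable.bdd_mul (c := Real.log 4 + 4) hexp
      (Complex.measurable_ofReal.comp measurable_psiExp).aestronglyMeasurable
      (Eventually.of_forall fun t => ?_)
    rw [Complex.norm_real, Real.norm_of_nonneg (psiExp_nonneg t)]
    exact psiExp_le t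
  have h1 := LSeries_vonMangoldt_eq_laplace hs1
  rw [show -(1 + w - 1) = -w by ring] at h1
  have h2 := vonMangoldt.eqOn_LFunctionResidueClassAux (q := 1) (a := 1) isUnit_one hs1
  simp only [residueClass_one_eq] at h2
  have h3 : psiBoundary ε u = (vonMangoldt.LFunctionResidueClassAux (1 : ZMod 1) (1 + w) - 1)
      / (1 + w) := by
    rw [psiBoundary, max_eq_left hε.le, hw, add_assoc]
  have h4 : ∫ t in Ioi (0 : ℝ), Complex.exp (-w * t) = 1 / w := by
    rw [integral_exp_mul_complex_Ioi hneg]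
    simp
  have h5 : ∫ t in Ioi (0 : ℝ), ((psiExp t - 1 : ℝ) : ℂ) * Complex.exp (-w * t)
      = (∫ t in Ioi (0 : ℝ), (psiExp t : ℂ) * Complex.exp (-w * t))
        - ∫ t in Ioi (0 : ℝ), Complex.exp (-w * t) := by
    rw [← integral_sub hmul hexp]
    refine integral_congr_ae (Eventually.of_forall fun t => ?_)
    push_cast
    ring
  rw [h5, h4, h3, h2, h1]
  simp only [Nat.totient_one, Nat.cast_one, inv_one, add_sub_cancel_left]
  field_simp
  ring

/-- Upper bound half of the prime number theorem. -/
theorem eventually_psi_le {c : ℝ} (hc : 1 < c) : ∀ᶠ x in atTop, Chebyshev.psi x ≤ c * x := by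
  have h := eventually_le_of_laplace_continuous measurable_psiExp psiExp_nonneg
    (fun t _ => abs_psiExp_sub_one_le t) (fun z t => psiExp_mul_exp_le) continuous_psiBoundary
    (fun ε hε u => integral_psiExp_sub_one_eq hε u) hc
  filter_upwards [Real.tendsto_log_atTop.eventually h, eventually_gt_atTop 0] with x hx hx0
  rw [psiExp, Real.exp_log hx0, Real.exp_neg, Real.exp_log hx0, ← div_eq_mul_inv,
    div_le_iff₀ hx0] at hx
  exact hx

theorem eventually_log_lcmUpTo_le {c : ℝ} (hc : 1 < c) :
    ∀ᶠ n : ℕ in atTop, Real.log (PCF.lcmUpTo n) ≤ c * n := by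
  filter_upwards [tendsto_natCast_atTop_atTop.eventually (eventually_psi_le hc)] with n hn
  rwa [Chebyshev.psi_eq_log_lcmUpto] at hn

end PrimeNumberTheorem

/-! ### Legendre recursion, generating series and divisibility -/

section LegendreSequences

/-- The solution of the Legendre recursion `(n+2) uₙ₊₂ = (2n+3) k uₙ₊₁ - (n+1) uₙ` with
`u₀ = s` and `u₁ = t`. -/
noncomputable def legSeq (k s t : ℚ) : ℕ → ℚ
  | 0 => s
  | 1 => t
  | n + 2 => ((2 * n + 3) * k * legSeq k s t (n + 1) - (n + 1) * legSeq k s t n) / (n + 2)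

theorem legSeq_rec (k s t : ℚ) (n : ℕ) :
    (n + 2) * legSeq k s t (n + 2)
      = (2 * n + 3) * k * legSeq k s t (n + 1) - (n + 1) * legSeq k s t n := by
  rw [legSeq]
  have : (n : ℚ) + 2 ≠ 0 := by positivity
  field_simp

theorem eval_aPoly (k x : ℤ) : (PCF.aPoly k).eval x = k * (2 * x + 1) := by
  simp [PCF.aPoly]

theorem eval_bPoly (x : ℤ) : PCF.bPoly.eval x = -x ^ 2 := by
  simp [PCF.bPoly]

theorem recSeq_eq_factorial_mul_legSeq (k s t : ℤ) (n : ℕ) :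
    (PCF.recSeq (PCF.aPoly k) PCF.bPoly s t n : ℚ) = (n + 1)! * legSeq k s t (n + 1) := by
  induction n using Nat.twoStepInduction with
  | zero => simp [PCF.recSeq, legSeq]
  | one =>
    have := legSeq_rec k s t 0
    simp [PCF.recSeq, eval_aPoly, eval_bPoly, legSeq, Nat.factorial] at this ⊢
    ring
  | more n h0 h1 =>
    have := legSeq_rec k s t (n + 1)
    rw [PCF.recSeq]
    rw [eval_aPoly, eval_bPoly]
    push_cast at this ⊢
    rw [h0, h1, Nat.factorial_succ (n + 2), Nat.factorial_succ (n + 1)]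
    push_cast
    linear_combination -((n + 2 : ℚ) * (n + 1)!) * this

/-- Generating series of the Legendre recursion. -/
theorem legSeq_series_ode (k s t : ℚ) :
    (1 - PowerSeries.C (2 * k) * PowerSeries.X + PowerSeries.X ^ 2 : PowerSeries ℚ) * PowerSeries.derivative ℚ (PowerSeries.mk (legSeq k s t))
      = (PowerSeries.C k - PowerSeries.X) * PowerSeries.mk (legSeq k s t) + PowerSeries.C (t - k * s) := by
  have e : ∀ F : PowerSeries ℚ, (1 - PowerSeries.C (2 * k) * PowerSeries.X + PowerSeries.X ^ 2) * F
      = F - PowerSeries.C (2 * k) * (PowerSeries.X * F) + PowerSeries.X * (PowerSeries.X * F) := fun F => by ring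
  have e' : ∀ F : PowerSeries ℚ, (PowerSeries.C k - PowerSeries.X) * F = PowerSeries.C k * F - PowerSeries.X * F := fun F => by ring
  rw [e, e']
  ext n
  rcases n with _ | _ | n
  · simp
    rw [← PowerSeries.coeff_zero_eq_constantCoeff_apply, PowerSeries.coeff_derivative]
    simp [legSeq]
  · have := legSeq_rec k s t 0
    simp [-map_mul, PowerSeries.coeff_derivative, PowerSeries.coeff_succ_X_mul, legSeq] at this ⊢
    rw [map_mul, PowerSeries.constantCoeff_X]
    linarith
  · have := legSeq_rec k s t (n + 1)
    simp [-map_mul, PowerSeries.coeff_derivative, PowerSeries.coeff_succ_X_mul] at this ⊢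
    linarith

/-- For `s = 1`, `t = k` the differential equation is homogeneous, so the left side has zero
derivative; its constant term is `1`. -/
theorem legSeq_series_sq (k : ℚ) :
    (1 - PowerSeries.C (2 * k) * PowerSeries.X + PowerSeries.X ^ 2 : PowerSeries ℚ) * (PowerSeries.mk (legSeq k 1 k) * PowerSeries.mk (legSeq k 1 k)) = 1 := by
  have h := legSeq_series_ode k 1 k
  set G : PowerSeries ℚ := PowerSeries.mk (legSeq k 1 k) with hG
  refine PowerSeries.derivative.ext ?_ ?_
  · simp only [Derivation.leibniz, map_add, map_sub, map_one, smul_eq_mul, Derivation.map_one_eq_zero,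
      PowerSeries.derivative_X, PowerSeries.derivative_C, PowerSeries.derivative_pow, map_mul] at h ⊢
    simp only [map_ofNat] at h ⊢
    simp at h ⊢
    linear_combination (2 * G) * h
  · simp [hG, legSeq]

/-- Variation of constants, `W = G ∫ G`. The coefficient of `∫ G` at `n = 0` is a division by zero,
hence `0`, the correct constant of integration. -/
theorem legSeq_series_second (k : ℚ) :
    PowerSeries.mk (legSeq k 0 1)
      = PowerSeries.mk (fun n : ℕ => legSeq k 1 k (n - 1) / n) * PowerSeries.mk (legSeq k 1 k) := by
  have h := legSeq_series_ode k 1 k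
  have hw := legSeq_series_ode k 0 1
  have hsq := legSeq_series_sq k
  have hI : PowerSeries.derivative ℚ (PowerSeries.mk fun n : ℕ => legSeq k 1 k (n - 1) / n) = PowerSeries.mk (legSeq k 1 k) := by
    ext n
    have : (n : ℚ) + 1 ≠ 0 := by positivity
    simp [PowerSeries.coeff_derivative]
    field_simp
  set G : PowerSeries ℚ := PowerSeries.mk (legSeq k 1 k) with hG
  set W : PowerSeries ℚ := PowerSeries.mk (legSeq k 0 1) with hW
  set J : PowerSeries ℚ := PowerSeries.mk fun n : ℕ => legSeq k 1 k (n - 1) / n with hJ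
  -- The factor multiplying `W` is `1/G`, so this says `W/G = ∫ G`.
  have key : W * ((1 - PowerSeries.C (2 * k) * PowerSeries.X + PowerSeries.X ^ 2) * G) = J := by
    refine PowerSeries.derivative.ext ?_ ?_
    · rw [hI]
      simp only [Derivation.leibniz, map_add, map_sub, map_one, smul_eq_mul,
        Derivation.map_one_eq_zero, PowerSeries.derivative_X, PowerSeries.derivative_C, PowerSeries.derivative_pow, map_mul] at h hw ⊢
      simp only [map_ofNat] at h hw ⊢
      simp at h hw ⊢
      linear_combination W * h + G * hw
    · simp [hW, hJ, legSeq]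
  rw [← key]
  linear_combination -W * hsq

theorem sum_legSeq_mul (k : ℚ) (n : ℕ) :
    legSeq k 0 1 n
      = ∑ p ∈ Finset.HasAntidiagonal.antidiagonal n, legSeq k 1 k (p.1 - 1) / p.1 * legSeq k 1 k p.2 := by
  have := congrArg (PowerSeries.coeff n) (legSeq_series_second k)
  rw [PowerSeries.coeff_mul] at this
  simpa using this

/-- The coefficients of `(1 - 2kX + X²)⁻¹`. -/
theorem coeff_legSeq_sq_mem (k : ℤ) (n : ℕ) :
    ∑ p ∈ Finset.HasAntidiagonal.antidiagonal n, legSeq k 1 k p.1 * legSeq k 1 k p.2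
      ∈ (Int.castRingHom ℚ).range := by
  have h := legSeq_series_sq k
  set F : PowerSeries ℚ := PowerSeries.mk (legSeq k 1 k) * PowerSeries.mk (legSeq k 1 k) with hF
  have hc : ∀ n, PowerSeries.coeff n F
      = ∑ p ∈ Finset.HasAntidiagonal.antidiagonal n, legSeq k 1 k p.1 * legSeq k 1 k p.2 := by
    intro n
    simp [hF, PowerSeries.coeff_mul]
  rw [← hc]
  have e : (1 - PowerSeries.C (2 * (k : ℚ)) * PowerSeries.X + PowerSeries.X ^ 2) * F
      = F - PowerSeries.C (2 * (k : ℚ)) * (PowerSeries.X * F)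
        + PowerSeries.X * (PowerSeries.X * F) := by ring
  rw [e] at h
  have hk2 : (2 * k : ℚ) ∈ (Int.castRingHom ℚ).range := ⟨2 * k, by simp⟩
  induction n using Nat.twoStepInduction with
  | zero =>
    have := congrArg (PowerSeries.coeff 0) h
    simp at this
    exact ⟨1, by simp [this]⟩
  | one =>
    rw [hc]
    exact ⟨2 * k, by simp [Finset.Nat.antidiagonal_succ, legSeq]; ring⟩
  | more n h0 h1 =>
    have := congrArg (PowerSeries.coeff (n + 2)) h
    simp [-map_mul, PowerSeries.coeff_succ_X_mul, PowerSeries.coeff_one] at this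
    rw [show PowerSeries.coeff (n + 2) F
      = 2 * k * PowerSeries.coeff (n + 1) F - PowerSeries.coeff n F by linarith]
    exact Subring.sub_mem _ (Subring.mul_mem _ hk2 h1) h0

/-- Strong induction on the integrality of `G²`: its coefficient at `m + 2` is `2 Pₘ₊₂` plus
products `Pᵢ₊₁ Pₘ₋ᵢ₊₁`, which `2^m` makes integral. One further factor `2` per step suffices. -/
theorem two_pow_mul_legSeq_succ_mem (k : ℤ) (n : ℕ) :
    2 ^ n * legSeq k 1 k (n + 1) ∈ (Int.castRingHom ℚ).range := by
  induction n using Nat.strong_induction_on with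
  | _ n ih =>
    have hP0 : legSeq k 1 k 0 = 1 := by rw [legSeq]
    have hP1 : legSeq k 1 k 1 = k := by rw [legSeq]
    rcases n with _ | m
    · exact ⟨k, by simp [hP1]⟩
    have hsum := Finset.Nat.sum_antidiagonal_eq_sum_range_succ
      (fun i j => legSeq k 1 k i * legSeq k 1 k j) (m + 2)
    -- Split off both end terms; each is `Pₘ₊₂`, as `P₀ = 1`.
    rw [Finset.sum_range_succ, Finset.sum_range_succ'] at hsum
    have hint : 2 ^ m * ∑ p ∈ Finset.HasAntidiagonal.antidiagonal (m + 2), legSeq k 1 k p.1 * legSeq k 1 k p.2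
        ∈ (Int.castRingHom ℚ).range :=
      Subring.mul_mem _ ⟨2 ^ m, by simp⟩ (coeff_legSeq_sq_mem k (m + 2))
    have hinner : ∑ i ∈ Finset.range (m + 1),
        (2 ^ i * legSeq k 1 k (i + 1)) * (2 ^ (m - i) * legSeq k 1 k (m - i + 1))
        ∈ (Int.castRingHom ℚ).range := by
      refine Subring.sum_mem _ fun i hi => ?_
      have hi' := Finset.mem_range.mp hi
      exact Subring.mul_mem _ (ih i hi') (ih (m - i) (by omega))
    have hinner' : ∑ i ∈ Finset.range (m + 1),
        (2 ^ i * legSeq k 1 k (i + 1)) * (2 ^ (m - i) * legSeq k 1 k (m - i + 1))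
        = 2 ^ m * ∑ i ∈ Finset.range (m + 1),
          legSeq k 1 k (i + 1) * legSeq k 1 k (m + 2 - (i + 1)) := by
      rw [Finset.mul_sum]
      refine Finset.sum_congr rfl fun i hi => ?_
      have hi' := Finset.mem_range.mp hi
      rw [show m + 2 - (i + 1) = m - i + 1 by omega]
      have : (2 : ℚ) ^ m = 2 ^ i * 2 ^ (m - i) := by rw [← pow_add]; congr 1; omega
      rw [this]
      ring
    have := Subring.sub_mem _ hint hinner
    rw [hinner', hsum] at this
    convert this using 1
    simp [hP0]
    ring

theorem two_pow_mul_legSeq_mem (k : ℤ) (n : ℕ) :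
    2 ^ n * legSeq k 1 k n ∈ (Int.castRingHom ℚ).range := by
  rcases n with _ | n
  · exact ⟨1, by simp [legSeq]⟩
  · have := Subring.mul_mem _ (⟨2, by simp⟩ : (2 : ℚ) ∈ (Int.castRingHom ℚ).range)
      (two_pow_mul_legSeq_succ_mem k n)
    rwa [← mul_assoc, ← pow_succ'] at this

theorem dvd_lcmUpTo {m n : ℕ} (h0 : 0 < m) (h : m ≤ n) : m ∣ PCF.lcmUpTo n :=
  Finset.dvd_lcm (f := id) (Finset.mem_Icc.mpr ⟨h0, h⟩)

theorem lcmUpTo_pos (n : ℕ) : 0 < PCF.lcmUpTo n :=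
  Nat.pos_of_dvd_of_pos (PCF.lcmUpTo_dvd_factorial n) n.factorial_pos

/-- Each summand is `Pᵢ Pⱼ / (i + 1)` with `i + j = n`: the lcm clears `i + 1`, and `2^n = 2^i 2^j`
clears the rest. -/
theorem lcmUpTo_mul_two_pow_mul_legSeq_mem (k : ℤ) (n : ℕ) :
    PCF.lcmUpTo (n + 1) * (2 ^ n * legSeq k 0 1 (n + 1)) ∈ (Int.castRingHom ℚ).range := by
  rw [sum_legSeq_mul, Finset.mul_sum, Finset.mul_sum]
  refine Subring.sum_mem _ fun p hp => ?_
  have hp' := Finset.HasAntidiagonal.mem_antidiagonal.mp hp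
  obtain ⟨i, j⟩ := p
  simp only at hp' ⊢
  rcases i with _ | i
  · simp
  obtain ⟨d, hd⟩ := dvd_lcmUpTo i.succ_pos (show i + 1 ≤ n + 1 by omega)
  have := Subring.mul_mem _ (⟨d, by simp⟩ : (d : ℚ) ∈ (Int.castRingHom ℚ).range)
    (Subring.mul_mem _ (two_pow_mul_legSeq_mem k i) (two_pow_mul_legSeq_mem k j))
  convert this using 1
  rw [hd, show n = i + j by omega, pow_add]
  have : (i : ℚ) + 1 ≠ 0 := by positivity
  push_cast
  field_simp

/-- Bridges an index shift: integrality naturally yields `(n+1)! / LCM[n+1]`, while the claim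
concerns index `n`. -/
theorem factorial_div_lcmUpTo_dvd_succ (n : ℕ) :
    n ! / PCF.lcmUpTo n ∣ (n + 1)! / PCF.lcmUpTo (n + 1) := by
  obtain ⟨d, hd⟩ := PCF.lcmUpTo_dvd_factorial n
  have h : PCF.lcmUpTo (n + 1) ∣ (n + 1) * PCF.lcmUpTo n := by
    refine Finset.lcm_dvd fun m hm => ?_
    obtain ⟨h1, h2⟩ := Finset.mem_Icc.mp hm
    rcases h2.eq_or_lt with h2 | h2
    · exact h2 ▸ dvd_mul_right _ _
    · exact (dvd_lcmUpTo h1 (by omega)).mul_left _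
  obtain ⟨e, he⟩ := h
  rw [Nat.factorial_succ, hd, Nat.mul_div_cancel_left _ (lcmUpTo_pos n), ← mul_assoc, he,
    mul_assoc, Nat.mul_div_cancel_left _ (lcmUpTo_pos _)]
  exact dvd_mul_left _ _

theorem num_eq_legSeq (k : ℤ) (n : ℕ) :
    (PCF.num (PCF.aPoly k) PCF.bPoly n : ℚ) = (n + 1)! * legSeq k 1 k (n + 1) := by
  have := recSeq_eq_factorial_mul_legSeq k 1 k n
  rw [PCF.num, show (PCF.aPoly k).eval 0 = k by simp [PCF.aPoly]]
  simpa using this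

theorem den_eq_legSeq (k : ℤ) (n : ℕ) :
    (PCF.den (PCF.aPoly k) PCF.bPoly n : ℚ) = (n + 1)! * legSeq k 0 1 (n + 1) := by
  have := recSeq_eq_factorial_mul_legSeq k 0 1 n
  simpa [PCF.den] using this

theorem factorial_div_lcmUpTo_dvd (n : ℕ) {u : ℤ} {x : ℚ} (hu : (u : ℚ) = (n + 1)! * x)
    (hx : PCF.lcmUpTo (n + 1) * (2 ^ n * x) ∈ (Int.castRingHom ℚ).range) :
    ((n ! / PCF.lcmUpTo n : ℕ) : ℤ) ∣ 2 ^ n * u := by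
  refine (Int.natCast_dvd_natCast.mpr (factorial_div_lcmUpTo_dvd_succ n)).trans ?_
  obtain ⟨z, hz⟩ := hx
  refine ⟨z, ?_⟩
  have hf := Nat.div_mul_cancel (PCF.lcmUpTo_dvd_factorial (n + 1))
  qify at hf
  qify
  rw [eq_intCast] at hz
  rw [hu, hz, ← hf]
  ring

/-- `n! / LCM[n]` divides `2ⁿ GCD[n]`. -/
theorem factorial_div_lcmUpTo_dvd_gcdSeq (k : ℤ) (n : ℕ) :
    n ! / PCF.lcmUpTo n ∣ 2 ^ n * PCF.gcdSeq (PCF.aPoly k) PCF.bPoly n := by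
  have h1 := factorial_div_lcmUpTo_dvd n (num_eq_legSeq k n)
    (Subring.mul_mem _ ⟨PCF.lcmUpTo (n + 1), by simp⟩ (two_pow_mul_legSeq_succ_mem k n))
  have h2 := factorial_div_lcmUpTo_dvd n (den_eq_legSeq k n)
    (lcmUpTo_mul_two_pow_mul_legSeq_mem k n)
  have h := Int.dvd_coe_gcd h1 h2
  rw [Int.gcd_mul_left, Int.natAbs_pow] at h
  exact Int.natCast_dvd_natCast.mp h

end LegendreSequences

/-! ### Growth of denominators and speed of convergence -/

section Growth

/-- The Legendre polynomial values `Pₙ(k)`, as real numbers. -/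
noncomputable def legP (k : ℤ) (n : ℕ) : ℝ := (legSeq k 1 k n : ℝ)

/-- The associated second solution of the Legendre recursion, as real numbers. -/
noncomputable def legW (k : ℤ) (n : ℕ) : ℝ := (legSeq k 0 1 n : ℝ)

theorem legP_rec (k : ℤ) (n : ℕ) :
    (n + 2) * legP k (n + 2) = (2 * n + 3) * k * legP k (n + 1) - (n + 1) * legP k n := by
  have := legSeq_rec k 1 k n
  unfold legP
  exact_mod_cast this

theorem legW_rec (k : ℤ) (n : ℕ) :
    (n + 2) * legW k (n + 2) = (2 * n + 3) * k * legW k (n + 1) - (n + 1) * legW k n := by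
  have := legSeq_rec k 0 1 n
  unfold legW
  exact_mod_cast this

@[simp] theorem legP_zero (k : ℤ) : legP k 0 = 1 := by simp [legP, legSeq]
@[simp] theorem legP_one (k : ℤ) : legP k 1 = k := by simp [legP, legSeq]
@[simp] theorem legW_zero (k : ℤ) : legW k 0 = 0 := by simp [legW, legSeq]
@[simp] theorem legW_one (k : ℤ) : legW k 1 = 1 := by simp [legW, legSeq]

theorem num_eq_legP (k : ℤ) (n : ℕ) :
    (PCF.num (PCF.aPoly k) PCF.bPoly n : ℝ) = (n + 1)! * legP k (n + 1) := by
  have := num_eq_legSeq k n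
  unfold legP
  exact_mod_cast this

theorem den_eq_legW (k : ℤ) (n : ℕ) :
    (PCF.den (PCF.aPoly k) PCF.bPoly n : ℝ) = (n + 1)! * legW k (n + 1) := by
  have := den_eq_legSeq k n
  unfold legW
  exact_mod_cast this

/-- The recursion rewrites as `(n+2)(uₙ₊₂ - uₙ₊₁) = (2n+3)(k-1) uₙ₊₁ + (n+1)(uₙ₊₁ - uₙ)`. -/
theorem nonneg_and_le_succ_of_legendre_rec {k : ℝ} (hk : 1 ≤ k) {u : ℕ → ℝ}
    (hu : ∀ n : ℕ, (n + 2) * u (n + 2) = (2 * n + 3) * k * u (n + 1) - (n + 1) * u n)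
    (h0 : 0 ≤ u 0) (h1 : u 0 ≤ u 1) (n : ℕ) : 0 ≤ u n ∧ u n ≤ u (n + 1) := by
  induction n with
  | zero => exact ⟨h0, h1⟩
  | succ n ih =>
    obtain ⟨ih0, ih1⟩ := ih
    have h := hu n
    have hn : (0 : ℝ) ≤ n := n.cast_nonneg
    have hpos : 0 ≤ u (n + 1) := ih0.trans ih1
    refine ⟨hpos, ?_⟩
    have e1 : 0 ≤ (2 * n + 3) * (k - 1) * u (n + 1) := by
      have := sub_nonneg.mpr hk
      positivity
    have e2 : 0 ≤ (n + 1) * (u (n + 1) - u n) :=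
      mul_nonneg (by positivity) (sub_nonneg.mpr ih1)
    refine le_of_mul_le_mul_left ?_ (by positivity : (0 : ℝ) < n + 2)
    nlinarith

theorem legP_nonneg {k : ℤ} (hk : 0 < k) (n : ℕ) : 0 ≤ legP k n := by
  have hk' : (1 : ℝ) ≤ k := by exact_mod_cast hk
  exact (nonneg_and_le_succ_of_legendre_rec hk' (legP_rec k) (by simp) (by simpa using hk') n).1

theorem monotone_legW {k : ℤ} (hk : 0 < k) : Monotone (legW k) := by
  have hk' : (1 : ℝ) ≤ k := by exact_mod_cast hk
  exact monotone_nat_of_le_succ fun n =>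
    (nonneg_and_le_succ_of_legendre_rec hk' (legW_rec k) (by simp) (by simp) n).2

theorem legW_succ_pos {k : ℤ} (hk : 0 < k) (n : ℕ) : 0 < legW k (n + 1) := by
  have := monotone_legW hk (Nat.le_add_left 1 n)
  rw [legW_one] at this
  linarith

theorem legP_legW_casoratian (k : ℤ) (n : ℕ) :
    (n + 1) * (legP k n * legW k (n + 1) - legP k (n + 1) * legW k n) = 1 := by
  induction n with
  | zero => simp
  | succ n ih =>
    have h1 := legP_rec k n
    have h2 := legW_rec k n
    push_cast
    linear_combination legP k (n + 1) * h2 - legW k (n + 1) * h1 + ih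

/-- The convergents of the continued fraction. -/
noncomputable def convergent (k : ℤ) (n : ℕ) : ℝ := legP k (n + 1) / legW k (n + 1)

theorem num_div_den (k : ℤ) (n : ℕ) :
    (PCF.num (PCF.aPoly k) PCF.bPoly n : ℝ) / (PCF.den (PCF.aPoly k) PCF.bPoly n : ℝ)
      = convergent k n := by
  have : ((n + 1)! : ℝ) ≠ 0 := by positivity
  rw [num_eq_legP, den_eq_legW, convergent, mul_div_mul_left _ _ this]

theorem convergent_sub_succ {k : ℤ} (hk : 0 < k) (n : ℕ) :
    convergent k n - convergent k (n + 1) = 1 / ((n + 2) * legW k (n + 2) * legW k (n + 1)) := by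
  have h1 := legW_succ_pos hk n
  have h2 := legW_succ_pos hk (n + 1)
  have h := legP_legW_casoratian k (n + 1)
  push_cast at h
  rw [convergent, convergent]
  field_simp
  linear_combination h

theorem strictAnti_convergent {k : ℤ} (hk : 0 < k) : StrictAnti (convergent k) := by
  refine strictAnti_nat_of_succ_lt fun n => ?_
  have h1 := legW_succ_pos hk n
  have h2 := legW_succ_pos hk (n + 1)
  have h := convergent_sub_succ hk n
  have : 0 < 1 / ((n + 2) * legW k (n + 2) * legW k (n + 1)) := by positivity
  linarith

theorem exists_tendsto_convergent {k : ℤ} (hk : 0 < k) :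
    ∃ L, Tendsto (convergent k) atTop (𝓝 L) := by
  refine ⟨_, tendsto_atTop_ciInf (strictAnti_convergent hk).antitone ⟨0, ?_⟩⟩
  rintro _ ⟨n, rfl⟩
  exact div_nonneg (legP_nonneg hk _) (legW_succ_pos hk n).le

theorem lt_convergent {k : ℤ} (hk : 0 < k) {L : ℝ} (hL : Tendsto (convergent k) atTop (𝓝 L))
    (n : ℕ) : L < convergent k n :=
  ((strictAnti_convergent hk).antitone.le_of_tendsto hL (n + 1)).trans_lt
    (strictAnti_convergent hk n.lt_succ_self)

theorem alpha_sq {k : ℤ} (hk : 0 < k) : PCF.alpha k ^ 2 = 2 * k * PCF.alpha k - 1 := by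
  have hk' : (1 : ℝ) ≤ k := by exact_mod_cast hk
  have := Real.sq_sqrt (show 0 ≤ (k : ℝ) ^ 2 - 1 by nlinarith)
  unfold PCF.alpha
  linear_combination this

theorem le_alpha (k : ℤ) : (k : ℝ) ≤ PCF.alpha k := by
  have := Real.sqrt_nonneg ((k : ℝ) ^ 2 - 1)
  unfold PCF.alpha
  linarith

theorem alpha_le {k : ℤ} (hk : 0 < k) : PCF.alpha k ≤ 2 * k := by
  have hk' : (0 : ℝ) ≤ k := by exact_mod_cast hk.le
  have := (Real.sqrt_le_sqrt (show (k : ℝ) ^ 2 - 1 ≤ (k : ℝ) ^ 2 by linarith)).trans_eq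
    (Real.sqrt_sq hk')
  unfold PCF.alpha
  linarith

/-- Serves the base case `W₂ = 3k/2 ≤ α W₁` of the upper bound; it fails for `k = 1`. -/
theorem mul_le_alpha {k : ℤ} (hk : 2 ≤ k) : 3 * (k : ℝ) / 2 ≤ PCF.alpha k := by
  have hk' : (2 : ℝ) ≤ k := by exact_mod_cast hk
  have := Real.le_sqrt_of_sq_le (show ((k : ℝ) / 2) ^ 2 ≤ (k : ℝ) ^ 2 - 1 by nlinarith)
  unfold PCF.alpha
  linarith

theorem three_le_alpha {k : ℤ} (hk : 2 ≤ k) : 3 ≤ PCF.alpha k := by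
  have hk' : (2 : ℝ) ≤ k := by exact_mod_cast hk
  linarith [mul_le_alpha hk]

/-- Multiplying the recursion by `α` lets the induction hypothesis bound the subtracted term; by `α²
= 2kα - 1` the slack is `(kα - 1) Wₙ₊₂`. -/
theorem legW_succ_succ_le {k : ℤ} (hk : 2 ≤ k) (n : ℕ) :
    legW k (n + 2) ≤ PCF.alpha k * legW k (n + 1) := by
  have hα := three_le_alpha hk
  have hsq := alpha_sq (show 0 < k by omega)
  have hk' : (2 : ℝ) ≤ k := by exact_mod_cast hk
  induction n with
  | zero =>
    have := legW_rec k 0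
    have := mul_le_alpha hk
    simp at *
    linarith
  | succ n ih =>
    have h := legW_rec k (n + 1)
    have hw := legW_succ_pos (show 0 < k by omega) (n + 1)
    push_cast at h
    refine le_of_mul_le_mul_left ?_ (by positivity : 0 < PCF.alpha k * (n + 3))
    have e1 := mul_le_mul_of_nonneg_left ih (by positivity : (0 : ℝ) ≤ n + 2)
    have e2 : 0 ≤ (k * PCF.alpha k - 1) * legW k (n + 2) :=
      mul_nonneg (by nlinarith) hw.le
    calc PCF.alpha k * (n + 3) * legW k (n + 1 + 2)
        = (2 * n + 5) * k * PCF.alpha k * legW k (n + 2)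
          - (n + 2) * (PCF.alpha k * legW k (n + 1)) := by
          linear_combination PCF.alpha k * h
      _ ≤ (2 * n + 5) * k * PCF.alpha k * legW k (n + 2) - (n + 2) * legW k (n + 2) := by
          linarith
      _ ≤ (2 * n + 5) * k * PCF.alpha k * legW k (n + 2) - (n + 2) * legW k (n + 2)
          + (k * PCF.alpha k - 1) * legW k (n + 2) := by linarith
      _ = PCF.alpha k * (n + 3) * (PCF.alpha k * legW k (n + 1 + 1)) := by
          linear_combination (-(n + 3) * legW k (n + 2)) * hsq

theorem legW_succ_le_pow {k : ℤ} (hk : 2 ≤ k) (n : ℕ) :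
    legW k (n + 1) ≤ PCF.alpha k ^ n := by
  have hα := three_le_alpha hk
  induction n with
  | zero => simp
  | succ n ih =>
    rw [pow_succ']
    exact (legW_succ_succ_le hk n).trans (by gcongr)

/-- The ratio of consecutive `W` stays below `α`; the weight `n + 1` compensates, at the cost of
only a polynomial factor. -/
theorem alpha_mul_legW_le {k : ℤ} (hk : 2 ≤ k) (n : ℕ) :
    PCF.alpha k * ((n + 1) * legW k (n + 1)) ≤ (n + 2) * legW k (n + 2) := by
  have hα := three_le_alpha hk
  have hsq := alpha_sq (show 0 < k by omega)
  have hk' : (2 : ℝ) ≤ k := by exact_mod_cast hk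
  induction n with
  | zero =>
    have := legW_rec k 0
    have := alpha_le (show 0 < k by omega)
    simp at *
    linarith
  | succ n ih =>
    have h := legW_rec k (n + 1)
    have hw := legW_succ_pos (show 0 < k by omega) (n + 1)
    push_cast at h ⊢
    refine le_of_mul_le_mul_left ?_ (by positivity : 0 < PCF.alpha k * (n + 1))
    have e1 := mul_le_mul_of_nonneg_left ih (by positivity : (0 : ℝ) ≤ n + 2)
    have e2 : 0 ≤ ((k * PCF.alpha k - 2) * (n + 1) + n) * legW k (n + 2) := by
      refine mul_nonneg (add_nonneg (mul_nonneg ?_ (by positivity)) (by positivity)) hw.le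
      nlinarith
    calc PCF.alpha k * (n + 1) * (PCF.alpha k * ((n + 1 + 1) * legW k (n + 1 + 1)))
        = (2 * n + 5) * k * PCF.alpha k * (n + 1) * legW k (n + 2)
          - (n + 2) * ((n + 2) * legW k (n + 2))
          - ((k * PCF.alpha k - 2) * (n + 1) + n) * legW k (n + 2) := by
          linear_combination ((n + 1) * (n + 2) * legW k (n + 2)) * hsq
      _ ≤ (2 * n + 5) * k * PCF.alpha k * (n + 1) * legW k (n + 2)
          - (n + 2) * (PCF.alpha k * ((n + 1) * legW k (n + 1))) := by linarith
      _ = PCF.alpha k * (n + 1) * ((n + 1 + 2) * legW k (n + 1 + 2)) := by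
          linear_combination (-PCF.alpha k * (n + 1)) * h

theorem pow_le_legW {k : ℤ} (hk : 2 ≤ k) (n : ℕ) :
    PCF.alpha k ^ n ≤ (n + 1) * legW k (n + 1) := by
  have hα := three_le_alpha hk
  induction n with
  | zero => simp
  | succ n ih =>
    rw [pow_succ']
    have := alpha_mul_legW_le hk n
    push_cast
    rw [show (n : ℝ) + 1 + 1 = n + 2 by ring]
    exact le_trans (by gcongr) this

theorem convergent_sub_succ_le {k : ℤ} (hk : 2 ≤ k) (n : ℕ) :
    convergent k n - convergent k (n + 1) ≤ (n + 1) / PCF.alpha k ^ (2 * n + 1) := by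
  have hα := three_le_alpha hk
  have h1 := pow_le_legW hk n
  have h2 := pow_le_legW hk (n + 1)
  have h3 := legW_succ_pos (show 0 < k by omega) n
  have h4 := legW_succ_pos (show 0 < k by omega) (n + 1)
  push_cast at h2
  rw [convergent_sub_succ (show 0 < k by omega), div_le_div_iff₀ (by positivity) (by positivity)]
  calc 1 * PCF.alpha k ^ (2 * n + 1) = PCF.alpha k ^ (n + 1) * PCF.alpha k ^ n := by ring
    _ ≤ ((n + 1 + 1) * legW k (n + 1 + 1)) * ((n + 1) * legW k (n + 1)) := by gcongr
    _ = (n + 1) * ((n + 2) * legW k (n + 2) * legW k (n + 1)) := by ring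

theorem convergent_sub_limit_le {k : ℤ} (hk : 2 ≤ k) {L : ℝ}
    (hL : Tendsto (convergent k) atTop (𝓝 L)) (n : ℕ) :
    convergent k n - L ≤ (n + 1) / PCF.alpha k ^ (2 * n) := by
  have hα := three_le_alpha hk
  -- Telescoping without a series: the majorant drops by at least as much as the convergent at each
  -- step, because `α ≥ 3`.
  have hmono : Monotone fun m : ℕ => convergent k m - (m + 1) / PCF.alpha k ^ (2 * m) := by
    refine monotone_nat_of_le_succ fun m => ?_
    have h := convergent_sub_succ_le hk m
    have hd : (m + 1) / PCF.alpha k ^ (2 * m + 1)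
        ≤ (m + 1) / PCF.alpha k ^ (2 * m) - ((m + 1 : ℕ) + 1) / PCF.alpha k ^ (2 * (m + 1)) := by
      rw [show 2 * (m + 1) = 2 * m + 2 by ring, pow_add, pow_add]
      have hp : 0 < PCF.alpha k ^ (2 * m) := by positivity
      have hm : (0 : ℝ) ≤ m := m.cast_nonneg
      push_cast
      rw [le_sub_iff_add_le, div_add_div _ _ (by positivity) (by positivity),
        div_le_div_iff₀ (by positivity) (by positivity)]
      have key : (m + 1) * PCF.alpha k + (m + 1 + 1) ≤ (m + 1) * PCF.alpha k ^ 2 := by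
        have : (m + 1) * PCF.alpha k * 3 ≤ (m + 1) * PCF.alpha k * PCF.alpha k := by gcongr
        nlinarith
      have := mul_le_mul_of_nonneg_left key
        (by positivity : 0 ≤ PCF.alpha k ^ (2 * m) * PCF.alpha k ^ (2 * m) * PCF.alpha k)
      linarith
    linarith
  have : convergent k n - (n + 1) / PCF.alpha k ^ (2 * n) ≤ L := by
    refine ge_of_tendsto hL ?_
    filter_upwards [eventually_ge_atTop n] with m hm
    have h := hmono hm
    have : 0 ≤ ((m : ℝ) + 1) / PCF.alpha k ^ (2 * m) := by positivity
    simp only at h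
    linarith
  linarith

end Growth

/-! ### The gcd rate, the effective measure and irrationality -/

section IrrationalityMeasure

theorem den_ne_zero {k : ℤ} (hk : 0 < k) (n : ℕ) : PCF.den (PCF.aPoly k) PCF.bPoly n ≠ 0 := by
  have h := den_eq_legW k n
  have hw := legW_succ_pos hk n
  have : (0 : ℝ) < (n + 1)! * legW k (n + 1) := by positivity
  rw [← h] at this
  exact_mod_cast this.ne'

theorem gcdSeq_pos {k : ℤ} (hk : 0 < k) (n : ℕ) :
    0 < PCF.gcdSeq (PCF.aPoly k) PCF.bPoly n :=
  Int.gcd_pos_of_ne_zero_right _ (den_ne_zero hk n)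

/-- `GCD[n] ≥ n! / (2ⁿ LCM[n])`. -/
theorem factorial_div_le_gcdSeq {k : ℤ} (hk : 0 < k) (n : ℕ) :
    (n ! : ℝ) / (2 ^ n * (PCF.lcmUpTo n : ℝ)) ≤ (PCF.gcdSeq (PCF.aPoly k) PCF.bPoly n : ℝ) := by
  have hl := lcmUpTo_pos n
  have h := Nat.le_of_dvd (Nat.mul_pos (by positivity) (gcdSeq_pos hk n))
    (factorial_div_lcmUpTo_dvd_gcdSeq k n)
  have h' := Nat.mul_le_mul_right (PCF.lcmUpTo n) h
  rw [Nat.div_mul_cancel (PCF.lcmUpTo_dvd_factorial n)] at h'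
  rw [div_le_iff₀ (by positivity)]
  have h'' : (n ! : ℝ) ≤ (2 ^ n * PCF.gcdSeq (PCF.aPoly k) PCF.bPoly n * PCF.lcmUpTo n : ℝ) := by
    exact_mod_cast h'
  linarith

theorem eventually_neg_le_log_gcdSeq_div {k : ℤ} (hk : 0 < k) {c : ℝ} (hc : 1 < c) :
    ∀ᶠ n : ℕ in atTop, -(Real.log 2 + c) * n
      ≤ Real.log ((PCF.gcdSeq (PCF.aPoly k) PCF.bPoly n : ℝ) / n !) := by
  filter_upwards [eventually_log_lcmUpTo_le hc] with n hn
  have hl : (0 : ℝ) < PCF.lcmUpTo n := by exact_mod_cast lcmUpTo_pos n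
  have hf : (0 : ℝ) < n ! := by positivity
  calc -(Real.log 2 + c) * n ≤ -(n * Real.log 2 + Real.log (PCF.lcmUpTo n)) := by linarith
    _ = Real.log (2 ^ n * (PCF.lcmUpTo n : ℝ))⁻¹ := by
      rw [Real.log_inv, Real.log_mul (by positivity) hl.ne', Real.log_pow]
    _ ≤ Real.log ((PCF.gcdSeq (PCF.aPoly k) PCF.bPoly n : ℝ) / n !) := by
      refine Real.log_le_log (by positivity) ?_
      rw [le_div_iff₀ hf, inv_mul_eq_div]
      exact factorial_div_le_gcdSeq hk n

theorem natDegree_aPoly {k : ℤ} (hk : k ≠ 0) : (PCF.aPoly k).natDegree = 1 := by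
  rw [show PCF.aPoly k = C (2 * k) * X + C k by
    rw [PCF.aPoly, C_mul]
    simp only [map_ofNat]
    ring]
  exact natDegree_linear (by simpa using hk)

theorem leadingCoeff_aPoly {k : ℤ} (hk : k ≠ 0) : (PCF.aPoly k).leadingCoeff = 2 * k := by
  rw [show PCF.aPoly k = C (2 * k) * X + C k by
    rw [PCF.aPoly, C_mul]
    simp only [map_ofNat]
    ring]
  exact leadingCoeff_linear (by simpa using hk)

theorem leadingCoeff_bPoly : PCF.bPoly.leadingCoeff = -1 := by
  simp [PCF.bPoly]

theorem neg_le_logLam {k : ℤ} (hk : 0 < k) :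
    ((-(Real.log 2 + 1) : ℝ) : EReal) ≤ PCF.logLam (PCF.aPoly k) PCF.bPoly := by
  refine le_of_forall_lt fun x hx => ?_
  obtain ⟨y, hxy, hy⟩ := EReal.lt_iff_exists_real_btwn.mp hx
  refine hxy.trans_le ?_
  rw [EReal.coe_lt_coe_iff] at hy
  refine le_limsup_of_frequently_le' (Eventually.frequently ?_)
  filter_upwards [eventually_neg_le_log_gcdSeq_div hk (show 1 < -y - Real.log 2 by linarith),
    eventually_gt_atTop 0] with n hn hn0
  have hg : (0 : ℝ) < PCF.gcdSeq (PCF.aPoly k) PCF.bPoly n := by exact_mod_cast gcdSeq_pos hk n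
  have hf : (0 : ℝ) < n ! := by positivity
  have hn0' : (0 : ℝ) < n := by exact_mod_cast hn0
  have e : (PCF.gcdSeq (PCF.aPoly k) PCF.bPoly n : ℝ≥0∞) / (n ! : ℝ≥0∞) ^ (PCF.aPoly k).natDegree
      = ENNReal.ofReal ((PCF.gcdSeq (PCF.aPoly k) PCF.bPoly n : ℝ) / n !) := by
    rw [natDegree_aPoly hk.ne', pow_one, ENNReal.ofReal_div_of_pos hf, ENNReal.ofReal_natCast,
      ENNReal.ofReal_natCast]
  rw [e, ENNReal.log_ofReal_of_pos (div_pos hg hf),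
    show ((n : ℕ) : EReal) = ((n : ℝ) : EReal) from rfl, ← EReal.coe_div, EReal.coe_le_coe_iff,
    le_div_iff₀ hn0']
  linarith

theorem ofReal_le_lam {k : ℤ} (hk : 0 < k) :
    ENNReal.ofReal (1 / (2 * Real.exp 1)) ≤ PCF.lam (PCF.aPoly k) PCF.bPoly := by
  have h := EReal.exp_monotone (neg_le_logLam hk)
  rw [EReal.exp_coe] at h
  have e : Real.exp (-(Real.log 2 + 1)) = 1 / (2 * Real.exp 1) := by
    rw [Real.exp_neg, Real.exp_add, Real.exp_log two_pos, one_div]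
  rw [e] at h
  exact h

theorem isDominantRoot_alpha {k : ℤ} (hk : 0 < k) :
    PCF.IsDominantRoot (PCF.aPoly k) PCF.bPoly (PCF.alpha k : ℂ) := by
  have hsq : (PCF.alpha k : ℂ) ^ 2 = 2 * k * PCF.alpha k - 1 := by exact_mod_cast alpha_sq hk
  rw [PCF.IsDominantRoot, leadingCoeff_aPoly hk.ne', leadingCoeff_bPoly]
  push_cast
  refine ⟨by rw [hsq]; ring, fun β hβ => ?_⟩
  have hle := le_alpha k
  have hle' := alpha_le hk
  have hk' : (0 : ℝ) < k := by exact_mod_cast hk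
  -- By Vieta the other root is `2k - α`, which lies in `[0, α]` since `k ≤ α ≤ 2k`.
  have h : (β - PCF.alpha k) * (β - (2 * k - PCF.alpha k : ℝ)) = 0 := by
    push_cast
    linear_combination hβ - hsq
  rcases mul_eq_zero.mp h with h | h
  · rw [sub_eq_zero.mp h]
  · rw [sub_eq_zero.mp h, Complex.norm_real, Complex.norm_real, Real.norm_of_nonneg (by linarith),
      Real.norm_of_nonneg (by linarith)]
    linarith

/-- The denominator of the `n`-th convergent in lowest terms. -/
noncomputable def reducedDen (k : ℤ) (n : ℕ) : ℝ :=
  |(PCF.den (PCF.aPoly k) PCF.bPoly n : ℝ)| / (PCF.gcdSeq (PCF.aPoly k) PCF.bPoly n : ℝ)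

theorem one_le_reducedDen {k : ℤ} (hk : 0 < k) (n : ℕ) : 1 ≤ reducedDen k n := by
  have hg : (0 : ℝ) < PCF.gcdSeq (PCF.aPoly k) PCF.bPoly n := by exact_mod_cast gcdSeq_pos hk n
  rw [reducedDen, one_le_div hg]
  have h := Int.le_of_dvd (abs_pos.mpr (den_ne_zero hk n))
    ((dvd_abs _ _).mpr (Int.gcd_dvd_right (PCF.num (PCF.aPoly k) PCF.bPoly n)
      (PCF.den (PCF.aPoly k) PCF.bPoly n)))
  exact_mod_cast h

theorem reducedDen_le {k : ℤ} (hk : 2 ≤ k) (n : ℕ) :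
    reducedDen k n ≤ (n + 1) * (2 ^ n * PCF.lcmUpTo n * PCF.alpha k ^ n) := by
  have hk0 : 0 < k := by omega
  have hg : (0 : ℝ) < PCF.gcdSeq (PCF.aPoly k) PCF.bPoly n := by
    exact_mod_cast gcdSeq_pos hk0 n
  have hl : (0 : ℝ) < PCF.lcmUpTo n := by exact_mod_cast lcmUpTo_pos n
  have hw := legW_succ_pos hk0 n
  have h := factorial_div_le_gcdSeq hk0 n
  rw [div_le_iff₀ (by positivity)] at h
  rw [reducedDen, den_eq_legW, abs_of_pos (by positivity), div_le_iff₀ hg, Nat.factorial_succ]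
  push_cast
  calc ((n : ℝ) + 1) * n ! * legW k (n + 1)
      ≤ (n + 1) * (PCF.gcdSeq (PCF.aPoly k) PCF.bPoly n * (2 ^ n * PCF.lcmUpTo n))
        * PCF.alpha k ^ n := by
        gcongr
        exact legW_succ_le_pow hk n
    _ = _ := by ring

theorem one_add_deltaBound {k : ℤ} (hk : 0 < k) :
    (1 + PCF.deltaBound k) * (Real.log (PCF.alpha k) + Real.log 2 + 1)
      = 2 * Real.log (PCF.alpha k) := by
  have hk' : (1 : ℝ) ≤ k := by exact_mod_cast hk
  have h1 := Real.log_nonneg (hk'.trans (le_alpha k))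
  have h2 := Real.log_nonneg (one_le_two (α := ℝ))
  have : Real.log (PCF.alpha k) + Real.log 2 + 1 ≠ 0 := by positivity
  unfold PCF.deltaBound
  field_simp
  ring

theorem deltaBound_one : PCF.deltaBound 1 = -1 := by
  have h := one_add_deltaBound one_pos
  have h2 := Real.log_nonneg (one_le_two (α := ℝ))
  have h1 : PCF.alpha 1 = 1 := by simp [PCF.alpha]
  rw [h1, Real.log_one, mul_zero, zero_add] at h
  have := (mul_eq_zero.mp h).resolve_right (by positivity)
  linarith

/-- If `1 + δ ≤ 0` the right side is at least `1`, and convergence suffices. Otherwise take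
logarithms: the error exponent `2 ln α` beats `(1 + δ)(ln α + ln 2 + c)` for some `c > 1`. -/
theorem eventually_convergent_sub_lt {k : ℤ} (hk : 0 < k) {L : ℝ}
    (hL : Tendsto (convergent k) atTop (𝓝 L)) {δ : ℝ} (hδ : δ < PCF.deltaBound k) :
    ∀ᶠ n in atTop, convergent k n - L < 1 / reducedDen k n ^ (1 + δ) := by
  rcases le_or_gt (1 + δ) 0 with h0 | h0
  · have he : Tendsto (fun n => convergent k n - L) atTop (𝓝 0) := by
      simpa using hL.sub_const L
    filter_upwards [he.eventually_lt_const one_pos] with n hn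
    refine hn.trans_le ?_
    have hQ := one_le_reducedDen hk n
    rw [one_div, ← Real.rpow_neg (by linarith)]
    exact Real.one_le_rpow hQ (by linarith)
  -- For `k = 1` the bound equals `-1`, already covered by the trivial case.
  have hk2 : 2 ≤ k := by
    by_contra hcon
    have hk1 : k = 1 := by omega
    rw [hk1, deltaBound_one] at hδ
    linarith
  set A := Real.log (PCF.alpha k) with hA
  have hα := three_le_alpha hk2
  have hApos : 0 < A := Real.log_pos (by linarith)
  have hlog2 : 0 < Real.log 2 := Real.log_pos (by norm_num)
  have hlt : (1 + δ) * (A + Real.log 2 + 1) < 2 * A := by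
    rw [← one_add_deltaBound hk]
    gcongr
  obtain ⟨c, hc1, hc⟩ : ∃ c : ℝ, 1 < c ∧ (1 + δ) * (A + Real.log 2 + c) < 2 * A := by
    have ht : Tendsto (fun c : ℝ => (1 + δ) * (A + Real.log 2 + c)) (𝓝[>] 1)
        (𝓝 ((1 + δ) * (A + Real.log 2 + 1))) := by
      refine Tendsto.mono_left (Continuous.tendsto ?_ 1) nhdsWithin_le_nhds
      fun_prop
    exact ((ht.eventually_lt_const hlt).and self_mem_nhdsWithin).exists.imp
      fun c h => ⟨h.2, h.1⟩
  set η := 2 * A - (1 + δ) * (A + Real.log 2 + c) with hη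
  have hηpos : 0 < η := sub_pos.mpr hc
  -- The polynomial factors: `1 + δ` from the reduced denominator and `1` from the error. The `2` in
  -- the constant below absorbs `n + 1 < 2n`.
  have hlogsmall : ∀ᶠ n : ℕ in atTop, (2 + δ) * Real.log (n + 1) < η * n := by
    have h := (Real.isLittleO_log_id_atTop.bound
      (show 0 < η / (2 * (2 + δ)) by have : 0 < 2 + δ := by linarith
                                     positivity))
    have ht : Tendsto (fun n : ℕ => (n : ℝ) + 1) atTop atTop :=
      tendsto_atTop_add_const_right _ _ tendsto_natCast_atTop_atTop
    filter_upwards [ht.eventually h, eventually_gt_atTop 1] with n hn hn1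
    have hn1' : (1 : ℝ) < n := by exact_mod_cast hn1
    rw [id, Real.norm_of_nonneg (Real.log_nonneg (by linarith)),
      Real.norm_of_nonneg (by linarith), div_mul_eq_mul_div, le_div_iff₀ (by linarith)] at hn
    nlinarith
  filter_upwards [eventually_log_lcmUpTo_le hc1, hlogsmall] with n hlcm hsmall
  have hQ := one_le_reducedDen hk n
  have hepos : 0 < convergent k n - L := sub_pos.mpr (lt_convergent hk hL n)
  have hn1 : (0 : ℝ) < n + 1 := by positivity
  have hl : (0 : ℝ) < PCF.lcmUpTo n := by exact_mod_cast lcmUpTo_pos n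
  have hQlog : Real.log (reducedDen k n)
      ≤ Real.log (n + 1) + n * (A + Real.log 2 + c) := by
    have h := Real.log_le_log (by linarith) (reducedDen_le hk2 n)
    rw [Real.log_mul (by positivity) (by positivity), Real.log_mul (by positivity) (by positivity),
      Real.log_mul (by positivity) (by positivity), Real.log_pow, Real.log_pow] at h
    linarith
  have helog : Real.log (convergent k n - L) ≤ Real.log (n + 1) - 2 * n * A := by
    have h := Real.log_le_log hepos (convergent_sub_limit_le hk2 hL n)
    rw [Real.log_div (by positivity) (by positivity), Real.log_pow] at h
    push_cast at h
    linarith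
  rw [one_div, ← Real.rpow_neg (by linarith), Real.rpow_def_of_pos (by linarith),
    ← Real.log_lt_iff_lt_exp hepos]
  have := mul_le_mul_of_nonneg_left hQlog h0.le
  nlinarith

theorem isAdmissible_of_lt_deltaBound {k : ℤ} (hk : 0 < k) {L : ℝ}
    (hL : Tendsto (convergent k) atTop (𝓝 L)) {δ : ℝ} (hδ : δ < PCF.deltaBound k) :
    PCF.IsAdmissible (PCF.aPoly k) PCF.bPoly L δ := by
  filter_upwards [eventually_convergent_sub_lt hk hL hδ] with n hn
  have hlt := lt_convergent hk hL n
  rw [num_div_den]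
  refine ⟨hlt.ne', ?_⟩
  rw [abs_sub_comm, abs_of_pos (sub_pos.mpr hlt)]
  exact hn

theorem deltaBound_le_effMeasure {k : ℤ} (hk : 0 < k) {L : ℝ}
    (hL : Tendsto (convergent k) atTop (𝓝 L)) :
    (PCF.deltaBound k : EReal) ≤ PCF.effMeasure (PCF.aPoly k) PCF.bPoly L := by
  refine le_of_forall_lt fun x hx => ?_
  obtain ⟨y, hxy, hy⟩ := EReal.lt_iff_exists_real_btwn.mp hx
  rw [EReal.coe_lt_coe_iff] at hy
  exact hxy.trans_le (le_sSup ⟨y, isAdmissible_of_lt_deltaBound hk hL hy, rfl⟩)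

theorem deltaBound_pos {k : ℤ} (hk : 3 ≤ k) : 0 < PCF.deltaBound k := by
  have hk' : (3 : ℝ) ≤ k := by exact_mod_cast hk
  have hα : 2 * Real.exp 1 < PCF.alpha k := by
    have h1 := Real.exp_one_lt_d9
    -- `2.8² = 7.84 ≤ 8`, so `α ≥ 5.8`, above `2e ≈ 5.44`.
    have h2 := Real.le_sqrt_of_sq_le (show (2.8 : ℝ) ^ 2 ≤ (k : ℝ) ^ 2 - 1 by nlinarith)
    unfold PCF.alpha
    linarith
  have h := Real.log_lt_log (by positivity) hα
  rw [Real.log_mul two_ne_zero (Real.exp_pos 1).ne', Real.log_exp] at h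
  have hlog2 : 0 < Real.log 2 := Real.log_pos (by norm_num)
  exact div_pos (by linarith) (by linarith)

/-- The numerator of the difference is a nonzero integer divisible by `GCD[n]`, hence at least
`GCD[n]` in absolute value. -/
theorem one_div_le_abs_rat_sub {k : ℤ} (hk : 0 < k) (r : ℚ) (n : ℕ)
    (hne : (PCF.num (PCF.aPoly k) PCF.bPoly n : ℝ) / (PCF.den (PCF.aPoly k) PCF.bPoly n : ℝ) ≠ r) :
    1 / (r.den * reducedDen k n)
      ≤ |(r : ℝ) - (PCF.num (PCF.aPoly k) PCF.bPoly n : ℝ)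
          / (PCF.den (PCF.aPoly k) PCF.bPoly n : ℝ)| := by
  set p := PCF.num (PCF.aPoly k) PCF.bPoly n with hp
  have hq0 := den_ne_zero hk n
  have hg : (0 : ℝ) < PCF.gcdSeq (PCF.aPoly k) PCF.bPoly n := by exact_mod_cast gcdSeq_pos hk n
  rw [reducedDen]
  set q := PCF.den (PCF.aPoly k) PCF.bPoly n with hq
  have hq0' : (q : ℝ) ≠ 0 := by exact_mod_cast hq0
  have hd0 : (r.den : ℝ) ≠ 0 := by exact_mod_cast r.den_ne_zero
  have hr : (r : ℝ) = r.num / r.den := by exact_mod_cast (Rat.num_div_den r).symm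
  have e : (r : ℝ) - p / q = ((r.num * q - p * r.den : ℤ) : ℝ) / (r.den * q) := by
    rw [hr]
    push_cast
    field_simp
  have hz : r.num * q - p * r.den ≠ 0 := by
    intro h
    rw [h, Int.cast_zero, zero_div, sub_eq_zero] at e
    exact hne e.symm
  have hdvd : (PCF.gcdSeq (PCF.aPoly k) PCF.bPoly n : ℤ) ∣ r.num * q - p * r.den :=
    dvd_sub ((Int.gcd_dvd_right p q).mul_left _) ((Int.gcd_dvd_left p q).mul_right _)
  have hle : (PCF.gcdSeq (PCF.aPoly k) PCF.bPoly n : ℝ) ≤ |((r.num * q - p * r.den : ℤ) : ℝ)| := by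
    exact_mod_cast Int.le_of_dvd (abs_pos.mpr hz) ((dvd_abs _ _).mpr hdvd)
  rw [e, abs_div, abs_mul, Nat.abs_cast]
  have hqa : 0 < |(q : ℝ)| := abs_pos.mpr hq0'
  have hd : (0 : ℝ) < r.den := by exact_mod_cast r.den_pos
  calc 1 / (r.den * (|(q : ℝ)| / PCF.gcdSeq (PCF.aPoly k) PCF.bPoly n))
      = PCF.gcdSeq (PCF.aPoly k) PCF.bPoly n / (r.den * |(q : ℝ)|) := by
        field_simp
    _ ≤ _ := by gcongr

/-- For rational `L` with denominator `d`, the two bounds give `Q^δ < d`, so the reduced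
denominators `Q` stay bounded and the error stays away from `0`, contradicting convergence. No
growth of `Q` is required. -/
theorem irrational_of_isAdmissible {k : ℤ} (hk : 0 < k) {L δ : ℝ}
    (hL : Tendsto (convergent k) atTop (𝓝 L)) (hδ : 0 < δ)
    (h : PCF.IsAdmissible (PCF.aPoly k) PCF.bPoly L δ) : Irrational L := by
  rintro ⟨r, rfl⟩
  have hd : (0 : ℝ) < r.den := by exact_mod_cast r.den_pos
  set M : ℝ := (r.den : ℝ) ^ (1 / δ) with hM
  have hMpos : 0 < M := Real.rpow_pos_of_pos hd _
  have he : Tendsto (fun n => convergent k n - r) atTop (𝓝 0) := by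
    simpa using hL.sub_const (r : ℝ)
  have hsmall := he.eventually_lt_const (show 0 < 1 / (r.den * M) by positivity)
  obtain ⟨n, ⟨hne, hlt⟩, hn⟩ := (h.and hsmall).exists
  have hlow := one_div_le_abs_rat_sub hk r n hne
  change _ < 1 / reducedDen k n ^ (1 + δ) at hlt
  have hQ := one_le_reducedDen hk n
  have hQpos : 0 < reducedDen k n := by linarith
  have h1 := hlow.trans_lt hlt
  rw [one_div_lt_one_div (by positivity) (by positivity), Real.rpow_add hQpos, Real.rpow_one,
    mul_comm, mul_lt_mul_iff_left₀ hQpos] at h1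
  have h2 : reducedDen k n < M := by
    have := Real.rpow_lt_rpow (by positivity) h1 (show 0 < 1 / δ by positivity)
    rwa [← Real.rpow_mul hQpos.le, mul_one_div_cancel hδ.ne', Real.rpow_one] at this
  rw [num_div_den, abs_sub_comm, abs_of_pos (sub_pos.mpr (lt_convergent hk hL n))] at hlow
  have h3 : 1 / (r.den * M) ≤ 1 / (r.den * reducedDen k n) := by gcongr
  linarith

end IrrationalityMeasure

theorem mainTheorem4 (k : ℤ) (hk : 0 < k) :
    -- `α = k + √(k² - 1)` is the dominant root of the characteristic equation
    PCF.IsDominantRoot (PCF.aPoly k) PCF.bPoly (PCF.alpha k : ℂ) ∧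
    -- `n! / LCM[n]` divides `2ⁿ GCD[n]`
    (∀ n : ℕ, n ! / PCF.lcmUpTo n ∣ 2 ^ n * PCF.gcdSeq (PCF.aPoly k) PCF.bPoly n) ∧
    -- `GCD[n] ≥ n! / (2ⁿ LCM[n])`
    (∀ n : ℕ, (n ! : ℝ) / (2 ^ n * (PCF.lcmUpTo n : ℝ))
      ≤ (PCF.gcdSeq (PCF.aPoly k) PCF.bPoly n : ℝ)) ∧
    -- `λ ≥ 1 / (2e)`
    ENNReal.ofReal (1 / (2 * Real.exp 1)) ≤ PCF.lam (PCF.aPoly k) PCF.bPoly ∧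
    -- the convergents are defined and converge to a limit `L`, with the stated bound for `δ`
    (∀ n : ℕ, PCF.den (PCF.aPoly k) PCF.bPoly n ≠ 0) ∧
    ∃ L : ℝ,
      Tendsto (fun n : ℕ => (PCF.num (PCF.aPoly k) PCF.bPoly n : ℝ) /
        (PCF.den (PCF.aPoly k) PCF.bPoly n : ℝ)) atTop (𝓝 L) ∧
      (PCF.deltaBound k : EReal) ≤ PCF.effMeasure (PCF.aPoly k) PCF.bPoly L ∧
      (3 ≤ k → 0 < PCF.deltaBound k ∧ Irrational L) := by
  obtain ⟨L, hL⟩ := exists_tendsto_convergent hk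
  refine ⟨isDominantRoot_alpha hk, factorial_div_lcmUpTo_dvd_gcdSeq k, factorial_div_le_gcdSeq hk,
    ofReal_le_lam hk, den_ne_zero hk, L, ?_, deltaBound_le_effMeasure hk hL, fun hk3 => ?_⟩
  · simpa only [num_div_den] using hL
  · have hpos := deltaBound_pos hk3
    exact ⟨hpos, irrational_of_isAdmissible hk hL (half_pos hpos)
      (isAdmissible_of_lt_deltaBound hk hL (half_lt_self hpos))⟩
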